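/- **Setting.** A MAPF instance consists of a finite undirected graph and $k$ agents $a_1,\dots,a_k$ with pairwise distinct start vertices $s_i$ and pairwise distinct target vertices $l_i$. At each timestep an agent moves to an adjacent vertex or waits. A path of $a_i$ goes from $s_i$ to $l_i$, where the agent then waits forever; its cost is the first timestep from which on it stays at $l_i$. Two paths have a vertex conflict at $t$ if they are at the same vertex at $t$, and an edge conflict at $t$ if they traverse the same edge in opposite directions between $t$ and $t+1$. A solution is a set of pairwise conflict-free paths, one for each agent; its SOC is the sum of the path costs, and $C^*$ is the minimum SOC of a solution. Let $w\ge 1$ be real. **EECBS.** A constraint tree (CT) node $N$ stores for each agent a finite set $\Psi_i(N)$ of constraints (vertex constraints: do not be at $v$ at timestep $t$; edge constraints: do not move from $u$ to $v$ between $t$ and $t+1$), a path of cost $c_i(N)$ that satisfies them, and a lower bound $lb_i(N)$. Put $C(N)=\sum_i c_i(N)$ and $LB(N)=\sum_i lb_i(N)$. The root has no constraints; its paths are found agent by agent (in any order) by the low-level search below with parent bound $0$ and $\Delta_i=0$. While there are generated but not yet expanded CT nodes, EECBS selects one of them, $\hat N$, with $C(\hat N)\le w\cdot LB$, where $LB$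 is the minimum of $LB(N)$ over all of them. If the paths of $\hat N$ have no conflict, they are returned. Otherwise any conflict, say between $a_i$ and $a_j$, is selected, and $\hat N$ is replaced by up to two children: one adds to $\Psi_i(\hat N)$ the constraint that forbids $a_i$ its part of the conflict and replans $a_i$, the other does the same for $a_j$; the other agents keep their paths and lower bounds, and a child is added only if the low-level search finds a path. If no generated, unexpanded node is left, or no path is found for some agent in the root, EECBS reports failure. **Low level.** To replan $a_i$ in a child $N$ of $\hat N$, focal search explores pairs $n=(v,t)$ of a vertex and a timestep from $(s_i,0)$, along moves that satisfy $\Psi_i(N)$, with $f_i(n)=t+h_i(v)$, where $h_i$ (which may depend on $\Psi_i(N)$) is a heuristic with nonnegative integer values that never overestimates the remaining number of timesteps to $l_i$ on a path of $a_i$ satisfying $\Psi_i(N)$. In each iteration let $f_{\min,i}$ be the minimum of $f_i$ over the generated, unexpanded nodes, and let $$\tau_i = w\cdot\max\{f_{\min,i},\,lb_i(\hat N)\}+\Delta_i .$$ Among the generated, unexpanded nodes with $f_i(n)\le\tau_i$ one with the fewest conflicts with the other agents' paths is taken. If it is at $l_i$ and the agent can stay there forever without violating a constraint, the search ends with the corresponding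 path and with $lb_i(N)=\max\{f_{\min,i},lb_i(\hat N)\}$; otherwise the node is expanded. Duplicates (same $v$ and $t$) may be discarded as long as one is kept. The search ends without a path when no unexpanded node is left. **Flex.** Let $\Delta_{\max,i}=\sum_{j\ne i}\bigl(w\cdot lb_j(\hat N)-c_j(\hat N)\bigr)$, and let $\rho_i$ be the number of conflicts of the path of $a_i$ with the other paths in $\hat N$, divided by the number of conflicts among all pairs of paths in $\hat N$. If $\Delta_{\max,i}<0$, then $\Delta_i=\Delta_{\max,i}$ (greedy flex distribution). If $\Delta_{\max,i}\ge 0$, then * Conflict-Based Flex Distribution (CFD) uses $\Delta_i=\rho_i\,\Delta_{\max,i}$; * Delay-Based Flex Distribution (DFD) uses $\Delta_i=\Delta_{d,i}+\rho_i\,(\Delta_{\max,i}-\Delta_{d,i})$ with $\Delta_{d,i}=\min\{\Delta_{\max,i},\sum_{\psi\in\Psi_i(N)}d_\psi\}$, where the $d_\psi$ are real-valued delay estimates (for instance $d_\psi=1$), which may depend on $\hat N$, $i$ and $\Psi_i(N)$, and whose sum $\sum_{\psi\in\Psi_i(N)}d_\psi$ is nonnegative. Each replanning may use either CFD or DFD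 (in particular, all may use CFD, or all may use DFD). **Theorem.** EECBS with CFD and/or DFD is complete and bounded-suboptimal, however the free choices above are made: 1. (completeness) if the instance has a solution, then every execution ends after finitely many steps, and it ends by returning a solution; 2. (bounded suboptimality) on every instance, whatever is returned is a solution whose SOC is at most $w\cdot C^*$. -/

import Mathlib

namespace MAPF

/-! ### Multi-agent path finding -/

/-- A MAPF instance with `k` agents on an undirected graph: every agent has a start vertex and a
target vertex, no two agents share a start and no two agents share a target. -/
structure Instance (V : Type*) (k : ℕ) where
  graph : SimpleGraph V
  start : Fin k → V
  target : Fin k → V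
  start_injective : Function.Injective start
  target_injective : Function.Injective target

/-- A vertex constraint `vertex v t` forbids an agent to be at `v` at timestep `t`; an edge
constraint `edge u v t` forbids an agent to move from `u` (at timestep `t`) to `v`
(at timestep `t + 1`). -/
inductive Constraint (V : Type*) where
  | vertex (v : V) (t : ℕ)
  | edge (u v : V) (t : ℕ)

/-- A trajectory (position at every timestep) respects a set of constraints. -/
def Satisfies {V : Type*} (Ψ : Finset (Constraint V)) (p : ℕ → V) : Prop :=
  (∀ v t, Constraint.vertex v t ∈ Ψ → p t ≠ v) ∧
    ∀ u v t, Constraint.edge u v t ∈ Ψ → ¬ (p t = u ∧ p (t + 1) = v)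

/-- Two agents are at the same vertex at timestep `t`. -/
def VertexConflict {V : Type*} (p q : ℕ → V) (t : ℕ) : Prop :=
  p t = q t

/-- Two agents traverse the same edge in opposite directions between `t` and `t + 1`. -/
def EdgeConflict {V : Type*} (p q : ℕ → V) (t : ℕ) : Prop :=
  p t ≠ p (t + 1) ∧ q t = p (t + 1) ∧ q (t + 1) = p t

/-- Number of (vertex and edge) conflicts between two paths. -/
noncomputable def numConflicts {V : Type*} (p q : ℕ → V) : ℕ :=
  {t | VertexConflict p q t}.ncard + {t | EdgeConflict p q t}.ncard

/-- Number of conflicts between two paths up to (and including the move into) timestep `T`. -/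
noncomputable def numConflictsUpTo {V : Type*} (T : ℕ) (p q : ℕ → V) : ℕ :=
  {t | t ≤ T ∧ VertexConflict p q t}.ncard + {t | t < T ∧ EdgeConflict p q t}.ncard

namespace Instance

variable {V : Type*} {k : ℕ} (I : Instance V k)

/-- A path of agent `i`: it begins at the start vertex, waits or moves along an edge at every
timestep, and from some timestep on it stays at the target vertex forever. -/
def IsPath (i : Fin k) (p : ℕ → V) : Prop :=
  p 0 = I.start i ∧ (∀ t, p (t + 1) = p t ∨ I.graph.Adj (p t) (p (t + 1))) ∧
    ∃ T, ∀ t, T ≤ t → p t = I.target i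

/-- The cost of a path: the first timestep from which on the agent stays at its target. -/
noncomputable def pathCost (i : Fin k) (p : ℕ → V) : ℕ :=
  sInf {T | ∀ t, T ≤ t → p t = I.target i}

/-- A solution: one path for each agent, without vertex conflicts and edge conflicts. -/
def IsSolution (P : Fin k → ℕ → V) : Prop :=
  (∀ i, I.IsPath i (P i)) ∧
    ∀ i j, i ≠ j → ∀ t, ¬ VertexConflict (P i) (P j) t ∧ ¬ EdgeConflict (P i) (P j) t

/-- The sum of path costs. -/
noncomputable def soc (P : Fin k → ℕ → V) : ℕ :=
  ∑ i, I.pathCost i (P i)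

/-- A solution whose sum of costs is at most `w` times the minimum sum of costs. -/
def IsBoundedSuboptimalSolution (w : ℝ) (P : Fin k → ℕ → V) : Prop :=
  I.IsSolution P ∧ ∃ Cstar : ℕ, IsLeast {c | ∃ Q, I.IsSolution Q ∧ I.soc Q = c} Cstar ∧
    (I.soc P : ℝ) ≤ w * Cstar

/-- `h i Ψ v` never exceeds the number of timesteps that agent `i` still needs from `v` to its
target on a path that satisfies the constraints `Ψ`. -/
def Admissible (h : Fin k → Finset (Constraint V) → V → ℕ) : Prop :=
  ∀ i Ψ p, I.IsPath i p → Satisfies Ψ p →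
    ∀ t, t ≤ I.pathCost i p → t + h i Ψ (p t) ≤ I.pathCost i p

end Instance

/-! ### Constraint tree nodes and flex -/

/-- A CT node: for each agent a set of constraints, a path and a lower bound on the cost of every
path of the agent that satisfies the constraints. -/
structure CTNode (V : Type*) (k : ℕ) where
  cons : Fin k → Finset (Constraint V)
  path : Fin k → ℕ → V
  lb : Fin k → ℕ

namespace CTNode

variable {V : Type*} {k : ℕ}

/-- `c_i(N)`. -/
noncomputable def cost (I : Instance V k) (N : CTNode V k) (i : Fin k) : ℕ :=
  I.pathCost i (N.path i)

/-- `C(N)`, the sum of costs. -/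
noncomputable def totalCost (I : Instance V k) (N : CTNode V k) : ℕ :=
  ∑ i, N.cost I i

/-- `LB(N)`, the sum of lower bounds. -/
def totalLB (N : CTNode V k) : ℕ :=
  ∑ i, N.lb i

/-- The number of conflicts between the path of agent `i` and the paths of the other agents. -/
noncomputable def agentConflicts (N : CTNode V k) (i : Fin k) : ℕ :=
  ∑ j ∈ Finset.univ.erase i, numConflicts (N.path i) (N.path j)

/-- The number of conflicts among all (unordered) pairs of paths. -/
noncomputable def allConflicts (N : CTNode V k) : ℕ :=
  ∑ i, ∑ j ∈ Finset.univ.filter (fun j => i < j), numConflicts (N.path i) (N.path j)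

/-- `ρ_i`, the share of agent `i` in the conflicts of the node. -/
noncomputable def conflictShare (N : CTNode V k) (i : Fin k) : ℝ :=
  (N.agentConflicts i : ℝ) / (N.allConflicts : ℝ)

/-- `Δ_{max,i}`, the maximum allowed flex. -/
noncomputable def maxFlex (I : Instance V k) (w : ℝ) (N : CTNode V k) (i : Fin k) : ℝ :=
  ∑ j ∈ Finset.univ.erase i, (w * (N.lb j : ℝ) - (N.cost I j : ℝ))

/-- The flex of Conflict-Based Flex Distribution. -/
noncomputable def flexCFD (I : Instance V k) (w : ℝ) (N : CTNode V k) (i : Fin k) : ℝ :=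
  if 0 ≤ N.maxFlex I w i then N.conflictShare i * N.maxFlex I w i else N.maxFlex I w i

/-- `Δ_{d,i}`, the part of the flex reserved for the total estimated delay `D`. -/
noncomputable def delayFlex (I : Instance V k) (w : ℝ) (N : CTNode V k) (i : Fin k) (D : ℝ) : ℝ :=
  min (N.maxFlex I w i) D

/-- The flex of Delay-Based Flex Distribution, for the total estimated delay `D`. -/
noncomputable def flexDFD (I : Instance V k) (w : ℝ) (N : CTNode V k) (i : Fin k) (D : ℝ) : ℝ :=
  if 0 ≤ N.maxFlex I w i then
    N.delayFlex I w i D + N.conflictShare i * (N.maxFlex I w i - N.delayFlex I w i D)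
  else N.maxFlex I w i

/-- `N` has a conflict between the agents `i` and `j`, and resolving it puts the constraint `ψi`
on agent `i` in one child, and the constraint `ψj` on agent `j` in the other child. -/
inductive Conflict (N : CTNode V k) : Fin k → Constraint V → Fin k → Constraint V → Prop where
  | vertex (i j : Fin k) (t : ℕ) (hij : i ≠ j) (hc : VertexConflict (N.path i) (N.path j) t) :
      Conflict N i (.vertex (N.path i t) t) j (.vertex (N.path j t) t)
  | edge (i j : Fin k) (t : ℕ) (hij : i ≠ j) (hc : EdgeConflict (N.path i) (N.path j) t) :
      Conflict N i (.edge (N.path i t) (N.path i (t + 1)) t)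
        j (.edge (N.path j t) (N.path j (t + 1)) t)

open Classical in
/-- `Ψ_i(N)` for the child `N` of `Nhat` that puts the constraint `ψ` on agent `i`. -/
noncomputable def childCons (Nhat : CTNode V k) (i : Fin k) (ψ : Constraint V) :
    Finset (Constraint V) :=
  insert ψ (Nhat.cons i)

/-- The child of `Nhat` that puts the constraint `ψ` on agent `i`, once a path `p` and a lower
bound `b` have been found for that agent; the other agents keep theirs. -/
noncomputable def child (Nhat : CTNode V k) (i : Fin k) (ψ : Constraint V) (p : ℕ → V) (b : ℕ) :
    CTNode V k where
  cons := Function.update Nhat.cons i (Nhat.childCons i ψ)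
  path := Function.update Nhat.path i p
  lb := Function.update Nhat.lb i b

end CTNode

/-- `LB`, the minimum of `LB(N)` over the generated but not yet expanded CT nodes. -/
noncomputable def globalLB {V : Type*} {k : ℕ} (L : Multiset (CTNode V k)) : ℕ :=
  sInf {b | ∃ N ∈ L, N.totalLB = b}

/-- The two flex distribution mechanisms. -/
inductive FlexMechanism where
  | CFD
  | DFD

/-- The data that fix the variant of EECBS: the suboptimality factor `w`, the low-level heuristic,
the estimated delays (`delay Nhat i Ψ ψ` is the estimated delay for agent `i` to satisfy `ψ`, when
it is replanned under the constraints `Ψ` in a child of `Nhat`), and the mechanism used when a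
child of `Nhat` replans agent `i` under the constraints `Ψ`. -/
structure Params (V : Type*) (k : ℕ) where
  w : ℝ
  h : Fin k → Finset (Constraint V) → V → ℕ
  delay : CTNode V k → Fin k → Finset (Constraint V) → Constraint V → ℝ
  mechanism : CTNode V k → Fin k → Finset (Constraint V) → FlexMechanism

/-- `Δ_i` for replanning agent `i` under the constraints `Ψ` in a child of `Nhat`. -/
noncomputable def Params.flex {V : Type*} {k : ℕ} (A : Params V k) (I : Instance V k)
    (Nhat : CTNode V k) (i : Fin k) (Ψ : Finset (Constraint V)) : ℝ :=
  match A.mechanism Nhat i Ψ with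
  | .CFD => Nhat.flexCFD I A.w i
  | .DFD => Nhat.flexDFD I A.w i (∑ ψ ∈ Ψ, A.delay Nhat i Ψ ψ)

/-! ### Low level: focal search -/

/-- A v-t node of the low-level search tree: the agent is at `traj time` at timestep `time`, and
`traj` records how it got there (the values of `traj` after `time` are those of an agent that
waits forever). -/
structure VTNode (V : Type*) where
  time : ℕ
  traj : ℕ → V

namespace VTNode

variable {V : Type*}

/-- The vertex of a v-t node. -/
def vtx (n : VTNode V) : V :=
  n.traj n.time

/-- The v-t node reached from `n` by moving to (or waiting at) `u`. -/
def extend (n : VTNode V) (u : V) : VTNode V where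
  time := n.time + 1
  traj := fun s => if s ≤ n.time then n.traj s else u

/-- Both nodes stand for the same pair of a vertex and a timestep. -/
def SameVT (m n : VTNode V) : Prop :=
  m.vtx = n.vtx ∧ m.time = n.time

end VTNode

/-- The input of a low-level search: the agent, its constraints, the lower bound `lb_i` inherited
from the parent, the flex `Δ_i`, and the paths of the other agents planned so far. -/
structure Query (V : Type*) (k : ℕ) where
  agent : Fin k
  cons : Finset (Constraint V)
  parentLB : ℕ
  flex : ℝ
  paths : Fin k → Option (ℕ → V)

/-- State of a focal search: the generated but not yet expanded nodes, and the expanded ones. -/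
structure SearchState (V : Type*) where
  opn : Set (VTNode V)
  closed : Set (VTNode V)

namespace Query

variable {V : Type*} {k : ℕ} (I : Instance V k) (A : Params V k) (q : Query V k)

/-- `f_i(n) = g_i(n) + h_i(v)`. -/
def f (n : VTNode V) : ℕ :=
  n.time + A.h q.agent q.cons n.vtx

/-- `x_i(n)`, the number of conflicts with the paths of the other agents on the way to `n`. -/
noncomputable def x (n : VTNode V) : ℕ :=
  ∑ j ∈ Finset.univ.erase q.agent,
    match q.paths j with
    | none => 0
    | some r => numConflictsUpTo n.time n.traj r

/-- The threshold `τ_i`, given the current minimum `fmin` of `f` over OPEN. -/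
noncomputable def threshold (fmin : ℕ) : ℝ :=
  A.w * ((max fmin q.parentLB : ℕ) : ℝ) + q.flex

/-- The initial state: the only open node is the start vertex at timestep 0 (unless a constraint
forbids it). -/
def initialState : SearchState V where
  opn := {n | n = ⟨0, fun _ => I.start q.agent⟩ ∧
    Constraint.vertex (I.start q.agent) 0 ∉ q.cons}
  closed := ∅

/-- The successors of `n` that satisfy the constraints. -/
def successors (n : VTNode V) : Set (VTNode V) :=
  {m | ∃ u, (u = n.vtx ∨ I.graph.Adj n.vtx u) ∧ Constraint.vertex u (n.time + 1) ∉ q.cons ∧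
    Constraint.edge n.vtx u n.time ∉ q.cons ∧ m = n.extend u}

/-- `n` is at the target and the agent can stay there forever without violating a constraint. -/
def IsGoal (n : VTNode V) : Prop :=
  n.vtx = I.target q.agent ∧
    Satisfies q.cons (fun t => if t ≤ n.time then n.traj t else I.target q.agent)

/-- `n` is a top node of FOCAL in the state `σ`, where `fmin` is the minimum of `f` over OPEN:
FOCAL holds the open nodes whose `f` is at most the threshold, and `n` has the fewest
conflicts among them. -/
def IsTop (σ : SearchState V) (fmin : ℕ) (n : VTNode V) : Prop :=
  IsLeast (q.f A '' σ.opn) fmin ∧ n ∈ σ.opn ∧ (q.f A n : ℝ) ≤ q.threshold A fmin ∧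
    ∀ m ∈ σ.opn, (q.f A m : ℝ) ≤ q.threshold A fmin → q.x n ≤ q.x m

/-- One iteration of focal search that does not end it: a top node of FOCAL, not a goal, is
expanded. Nodes may be dropped from OPEN as duplicates, but only if some generated node that is
kept stands for the same vertex and timestep (every policy for duplicates is allowed). -/
def Expands (σ σ' : SearchState V) : Prop :=
  ∃ fmin n, q.IsTop A σ fmin n ∧ ¬ q.IsGoal I n ∧ σ'.closed = insert n σ.closed ∧
    σ'.opn ⊆ (σ.opn \ {n}) ∪ q.successors I n ∧
    ∀ m ∈ (σ.opn \ {n}) ∪ q.successors I n, ∃ m' ∈ σ'.opn ∪ σ'.closed, m'.SameVT m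

/-- Focal search ends with the path `p` and the lower bound `b`. -/
def Finds (σ : SearchState V) (p : ℕ → V) (b : ℕ) : Prop :=
  ∃ fmin n, q.IsTop A σ fmin n ∧ q.IsGoal I n ∧
    p = (fun t => if t ≤ n.time then n.traj t else I.target q.agent) ∧ b = max fmin q.parentLB

/-- Focal search ends without a path. -/
def Fails (σ : SearchState V) : Prop :=
  σ.opn = ∅

end Query

/-! ### High level -/

/-- The low-level search for agent `i` in the root of the CT: no constraints, no flex. `plan` holds
the paths and the lower bounds found so far. -/
def rootQuery {V : Type*} {k : ℕ} (plan : Fin k → Option ((ℕ → V) × ℕ)) (i : Fin k) :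
    Query V k where
  agent := i
  cons := ∅
  parentLB := 0
  flex := 0
  paths := fun j => (plan j).map Prod.fst

/-- The low-level search for agent `i` in the child of `Nhat` with the new constraint `ψ`. -/
noncomputable def childQuery {V : Type*} {k : ℕ} (A : Params V k) (I : Instance V k)
    (Nhat : CTNode V k) (i : Fin k) (ψ : Constraint V) : Query V k where
  agent := i
  cons := Nhat.childCons i ψ
  parentLB := Nhat.lb i
  flex := A.flex I Nhat i (Nhat.childCons i ψ)
  paths := fun j => some (Nhat.path j)

/-- States of EECBS. -/
inductive State (V : Type*) (k : ℕ) where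
  /-- Building the root, between two low-level searches. -/
  | root (plan : Fin k → Option ((ℕ → V) × ℕ))
  /-- Building the root, searching a path for agent `i`. -/
  | rootSearch (plan : Fin k → Option ((ℕ → V) × ℕ)) (i : Fin k) (σ : SearchState V)
  /-- Main loop; `L` holds the generated but not yet expanded CT nodes. -/
  | main (L : Multiset (CTNode V k))
  /-- Expanding `Nhat`; `todo` lists the children that are still to be generated. -/
  | expand (L : Multiset (CTNode V k)) (Nhat : CTNode V k) (todo : List (Fin k × Constraint V))
  /-- Generating the child of `Nhat` with the constraint `ψ` on agent `i`. -/
  | childSearch (L : Multiset (CTNode V k)) (Nhat : CTNode V k)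
      (todo : List (Fin k × Constraint V)) (i : Fin k) (ψ : Constraint V) (σ : SearchState V)
  /-- A solution is returned. -/
  | solved (P : Fin k → ℕ → V)
  /-- "No solution" is reported. -/
  | failed

/-- One step of EECBS. All choices that the algorithm is free to make (ties, the order of the agents
in the root, the conflict to be resolved, which globally bounded-suboptimal CT node is selected) are
nondeterministic. -/
inductive Step {V : Type*} {k : ℕ} (I : Instance V k) (A : Params V k) :
    State V k → State V k → Prop where
  | rootStart (plan : Fin k → Option ((ℕ → V) × ℕ)) (i : Fin k) (hi : plan i = none) :
      Step I A (.root plan) (.rootSearch plan i ((rootQuery plan i).initialState I))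
  | rootExpands (plan : Fin k → Option ((ℕ → V) × ℕ)) (i : Fin k) (σ σ' : SearchState V)
      (h : (rootQuery plan i).Expands I A σ σ') :
      Step I A (.rootSearch plan i σ) (.rootSearch plan i σ')
  | rootFinds (plan : Fin k → Option ((ℕ → V) × ℕ)) (i : Fin k) (σ : SearchState V)
      (p : ℕ → V) (b : ℕ) (h : (rootQuery plan i).Finds I A σ p b) :
      Step I A (.rootSearch plan i σ) (.root (Function.update plan i (some (p, b))))
  | rootFails (plan : Fin k → Option ((ℕ → V) × ℕ)) (i : Fin k) (σ : SearchState V)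
      (h : Query.Fails σ) :
      Step I A (.rootSearch plan i σ) .failed
  | rootDone (P : Fin k → ℕ → V) (b : Fin k → ℕ) :
      Step I A (.root fun i => some (P i, b i)) (.main {⟨fun _ => ∅, P, b⟩})
  | exhausted : Step I A (.main 0) .failed
  | returns (L : Multiset (CTNode V k)) (Nhat : CTNode V k)
      (hsel : (Nhat.totalCost I : ℝ) ≤ A.w * (globalLB (Nhat ::ₘ L) : ℝ))
      (hno : ¬ ∃ i ψi j ψj, Nhat.Conflict i ψi j ψj) :
      Step I A (.main (Nhat ::ₘ L)) (.solved Nhat.path)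
  | expands (L : Multiset (CTNode V k)) (Nhat : CTNode V k)
      (hsel : (Nhat.totalCost I : ℝ) ≤ A.w * (globalLB (Nhat ::ₘ L) : ℝ))
      (i j : Fin k) (ψi ψj : Constraint V) (hconf : Nhat.Conflict i ψi j ψj) :
      Step I A (.main (Nhat ::ₘ L)) (.expand L Nhat [(i, ψi), (j, ψj)])
  | expandDone (L : Multiset (CTNode V k)) (Nhat : CTNode V k) :
      Step I A (.expand L Nhat []) (.main L)
  | childStart (L : Multiset (CTNode V k)) (Nhat : CTNode V k) (i : Fin k) (ψ : Constraint V)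
      (todo : List (Fin k × Constraint V)) :
      Step I A (.expand L Nhat ((i, ψ) :: todo))
        (.childSearch L Nhat todo i ψ ((childQuery A I Nhat i ψ).initialState I))
  | childExpands (L : Multiset (CTNode V k)) (Nhat : CTNode V k)
      (todo : List (Fin k × Constraint V)) (i : Fin k) (ψ : Constraint V) (σ σ' : SearchState V)
      (h : (childQuery A I Nhat i ψ).Expands I A σ σ') :
      Step I A (.childSearch L Nhat todo i ψ σ) (.childSearch L Nhat todo i ψ σ')
  | childFinds (L : Multiset (CTNode V k)) (Nhat : CTNode V k)
      (todo : List (Fin k × Constraint V)) (i : Fin k) (ψ : Constraint V) (σ : SearchState V)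
      (p : ℕ → V) (b : ℕ) (h : (childQuery A I Nhat i ψ).Finds I A σ p b) :
      Step I A (.childSearch L Nhat todo i ψ σ)
        (.expand (Nhat.child i ψ p b ::ₘ L) Nhat todo)
  | childFails (L : Multiset (CTNode V k)) (Nhat : CTNode V k)
      (todo : List (Fin k × Constraint V)) (i : Fin k) (ψ : Constraint V) (σ : SearchState V)
      (h : Query.Fails σ) :
      Step I A (.childSearch L Nhat todo i ψ σ) (.expand L Nhat todo)

/-- The initial state of EECBS: no agent has a path. -/
def initialState (V : Type*) (k : ℕ) : State V k :=
  .root fun _ => none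

/-- `s` occurs in some execution of EECBS. -/
def Reachable {V : Type*} {k : ℕ} (I : Instance V k) (A : Params V k) (s : State V k) : Prop :=
  Relation.ReflTransGen (Step I A) (initialState V k) s

/-- Completeness on the instance `I`: if `I` has a solution, then every execution ends after
finitely many steps, and it can only end by returning a solution. -/
def IsCompleteOn {V : Type*} {k : ℕ} (I : Instance V k) (A : Params V k) : Prop :=
  (∃ Q, I.IsSolution Q) →
    (¬ ∃ run : ℕ → State V k, run 0 = initialState V k ∧ ∀ n, Step I A (run n) (run (n + 1))) ∧
    ∀ s, Reachable I A s → (¬ ∃ s', Step I A s s') → ∃ P, s = .solved P ∧ I.IsSolution P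

/-- Bounded suboptimality on the instance `I`: whatever is returned is a solution whose sum of costs
is at most `w` times the minimum. -/
def IsBoundedSuboptimalOn {V : Type*} {k : ℕ} (I : Instance V k) (A : Params V k) : Prop :=
  ∀ P, Reachable I A (.solved P) → I.IsBoundedSuboptimalSolution A.w P

end MAPF

namespace MAPF

/-! The proof rests on validity of nodes, coverage of a solution, and a bound on timesteps.

Validity (`CTNode.Valid`): the lower bounds are correct and C(N) ≤ w·LB(N). Both mechanisms give a
flex between min(0, Δ_max) and Δ_max (`flex_mem_Icc`). The upper end keeps the cost of a child
within w times its own LB (`Valid.child`). The lower end, together with C ≤ w·LB at the parent,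
keeps FOCAL nonempty even when the flex is negative (`Valid.le_threshold`). So no low-level search
gets stuck, and the unexpanded node of least LB can always be selected.

Coverage (`State.Covers`): fix a solution `Q`. It respects at least one of the two constraints that
resolve a conflict, so some unexpanded node or pending child always permits `Q`. Hence LB is at most
the SOC of `Q` whenever a node is selected, and the selected node costs at most w·SOC(Q)
(`totalCost_le`). For an optimal `Q` this is bounded suboptimality.

Termination: after its total cost a node has all agents resting at distinct targets, so conflicts of
selected nodes have timesteps at most ⌊w·SOC(Q)⌋. Only finitely many constraints occur, and a child
has exactly one more than its parent. Low-level searches end because the nodes they can take have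
bounded timesteps, whether or not a path exists (`finite_searchSpace`). `work_lt` combines both
facts in a lexicographic measure. -/

/-! ### Path costs and constraints -/

/-- The timestep of a constraint. -/
def Constraint.time {V : Type*} : Constraint V → ℕ
  | .vertex _ t => t
  | .edge _ _ t => t

theorem Satisfies.mono {V : Type*} {Ψ Φ : Finset (Constraint V)} {p : ℕ → V} (h : Ψ ⊆ Φ)
    (hp : Satisfies Φ p) : Satisfies Ψ p :=
  ⟨fun v t hv => hp.1 v t (h hv), fun u v t hv => hp.2 u v t (h hv)⟩

theorem finite_constraint_time_le {V : Type*} [Finite V] (B : ℕ) :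
    {ψ : Constraint V | ψ.time ≤ B}.Finite := by
  have h : (Set.univ : Set (V × Fin (B + 1) ⊕ V × V × Fin (B + 1))).Finite := Set.finite_univ
  refine (h.image (fun x => match x with
    | .inl (v, t) => Constraint.vertex v t.1
    | .inr (u, v, t) => Constraint.edge u v t.1)).subset ?_
  rintro (⟨v, t⟩ | ⟨u, v, t⟩) hψ
  · exact ⟨.inl (v, ⟨t, Nat.lt_succ_of_le hψ⟩), trivial, rfl⟩
  · exact ⟨.inr (u, v, ⟨t, Nat.lt_succ_of_le hψ⟩), trivial, rfl⟩

namespace Instance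

variable {V : Type*} {k : ℕ} {I : Instance V k} {i : Fin k} {p : ℕ → V}

theorem IsPath.eq_target (hp : I.IsPath i p) {t : ℕ} (ht : I.pathCost i p ≤ t) :
    p t = I.target i :=
  Nat.sInf_mem (s := {T | ∀ t, T ≤ t → p t = I.target i}) hp.2.2 t ht

theorem pathCost_le {T : ℕ} (h : ∀ t, T ≤ t → p t = I.target i) : I.pathCost i p ≤ T :=
  Nat.sInf_le (s := {T | ∀ t, T ≤ t → p t = I.target i}) h

end Instance

/-- Every vertex reachable from `u` is the final vertex of some trajectory that starts at `u`. -/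
theorem exists_trajectory {V : Type*} {G : SimpleGraph V} {u v : V} (h : G.Reachable u v) :
    ∃ r : ℕ → V, r 0 = u ∧ (∀ t, r (t + 1) = r t ∨ G.Adj (r t) (r (t + 1))) ∧
      ∃ T, ∀ t, T ≤ t → r t = v := by
  obtain ⟨w⟩ := h
  refine ⟨w.getVert, w.getVert_zero, fun t => ?_, w.length, fun t ht => w.getVert_of_length_le ht⟩
  by_cases ht : t < w.length
  · exact .inr (w.adj_getVert_succ ht)
  · exact .inl (by rw [w.getVert_of_length_le (by omega), w.getVert_of_length_le (by omega)])

theorem reachable_of_moves {V : Type*} {G : SimpleGraph V} {r : ℕ → V} {T : ℕ}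
    (h : ∀ t, t < T → r (t + 1) = r t ∨ G.Adj (r t) (r (t + 1))) {t : ℕ} (ht : t ≤ T) :
    G.Reachable (r 0) (r t) := by
  induction t with
  | zero => exact .refl _
  | succ t ih =>
    have h1 := ih (by omega)
    rcases h t (by omega) with h2 | h2
    · rwa [h2]
    · exact h1.trans h2.reachable

/-! ### Focal search -/

namespace Query

variable {V : Type*} {k : ℕ} (I : Instance V k) (A : Params V k) (q : Query V k)

/-- The trajectory of `n` begins at the start vertex, consists of legal moves, respects the
constraints up to `n.time`, and is constant from then on. -/
structure WellFormed (n : VTNode V) : Prop where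
  zero : n.traj 0 = I.start q.agent
  move : ∀ t, t < n.time → n.traj (t + 1) = n.traj t ∨ I.graph.Adj (n.traj t) (n.traj (t + 1))
  const : ∀ t, n.time ≤ t → n.traj t = n.traj n.time
  vertex : ∀ t, t ≤ n.time → Constraint.vertex (n.traj t) t ∉ q.cons
  edge : ∀ t, t < n.time → Constraint.edge (n.traj t) (n.traj (t + 1)) t ∉ q.cons

/-- The invariant of focal search. -/
structure Inv (σ : SearchState V) : Prop where
  wf : ∀ n ∈ σ.opn ∪ σ.closed, q.WellFormed I n
  disj : ∀ n ∈ σ.opn, n ∉ σ.closed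
  parent : ∀ n ∈ σ.opn ∪ σ.closed, n.time = 0 ∨ ∃ m ∈ σ.closed, n ∈ q.successors I m
  notGoal : ∀ n ∈ σ.closed, ¬ q.IsGoal I n
  start : Constraint.vertex (I.start q.agent) 0 ∉ q.cons →
    ∃ m ∈ σ.opn ∪ σ.closed, m.vtx = I.start q.agent ∧ m.time = 0
  succ : ∀ n ∈ σ.closed, ∀ m ∈ q.successors I n, ∃ m' ∈ σ.opn ∪ σ.closed, m'.SameVT m

variable {I A q} {σ σ' : SearchState V} {n m : VTNode V} {p : ℕ → V} {b fmin : ℕ}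

theorem inv_initialState : q.Inv I (q.initialState I) := by
  have key : ∀ n ∈ (q.initialState I).opn ∪ (q.initialState I).closed,
      n = ⟨0, fun _ => I.start q.agent⟩ ∧ Constraint.vertex (I.start q.agent) 0 ∉ q.cons := by
    rintro n (hn | hn)
    · exact hn
    · exact hn.elim
  refine ⟨fun n hn => ?_, fun n _ h => h, fun n hn => ?_, fun n h => h.elim, fun h => ?_,
    fun n h => h.elim⟩
  · obtain ⟨rfl, h⟩ := key n hn
    refine ⟨rfl, fun t ht => absurd ht (Nat.not_lt_zero t), fun _ _ => rfl, fun t ht => ?_,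
      fun t ht => absurd ht (Nat.not_lt_zero t)⟩
    obtain rfl : t = 0 := Nat.le_zero.1 ht
    exact h
  · obtain ⟨rfl, h⟩ := key n hn
    exact .inl rfl
  · exact ⟨_, .inl ⟨rfl, h⟩, rfl, rfl⟩

theorem WellFormed.of_mem_successors (hn : q.WellFormed I n) (hm : m ∈ q.successors I n) :
    q.WellFormed I m := by
  obtain ⟨u, hu, hv, he, rfl⟩ := hm
  have hle : ∀ t, t ≤ n.time → (n.extend u).traj t = n.traj t := fun t ht => if_pos ht
  have hgt : ∀ t, n.time < t → (n.extend u).traj t = u := fun t ht => if_neg (by omega)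
  have htime : (n.extend u).time = n.time + 1 := rfl
  refine ⟨by rw [hle 0 (Nat.zero_le _), hn.zero], fun t ht => ?_, fun t ht => ?_, fun t ht => ?_,
    fun t ht => ?_⟩
  · rcases Nat.lt_or_ge t n.time with h | h
    · rw [hle t h.le, hle (t + 1) h]; exact hn.move t h
    · obtain rfl : t = n.time := by omega
      rw [hle _ le_rfl, hgt _ (Nat.lt_succ_self _)]; exact hu
  · rw [hgt t (by omega), hgt _ (by omega)]
  · rcases Nat.lt_or_ge n.time t with h | h
    · obtain rfl : t = n.time + 1 := by omega
      rwa [hgt _ h]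
    · rw [hle t h]; exact hn.vertex t h
  · rcases Nat.lt_or_ge t n.time with h | h
    · rw [hle t h.le, hle (t + 1) h]; exact hn.edge t h
    · obtain rfl : t = n.time := by omega
      rw [hle _ le_rfl, hgt _ (Nat.lt_succ_self _)]; exact he

/-- `extend` overwrites what the parent's trajectory does after its timestep, but by `const` that
part carries no information. -/
theorem WellFormed.parent_unique {m' : VTNode V} (hm : q.WellFormed I m)
    (hm' : q.WellFormed I m') (h : n ∈ q.successors I m) (h' : n ∈ q.successors I m') :
    m = m' := by
  obtain ⟨u, -, -, -, rfl⟩ := h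
  obtain ⟨u', -, -, -, h⟩ := h'
  obtain ⟨s, r⟩ := m
  obtain ⟨s', r'⟩ := m'
  simp only [VTNode.extend, VTNode.mk.injEq, Nat.add_right_cancel_iff] at h
  obtain ⟨rfl, h⟩ := h
  have hle : ∀ t, t ≤ s → r t = r' t := fun t ht => by simpa [ht] using congrFun h t
  congr 1
  funext t
  rcases Nat.le_total t s with ht | ht
  · exact hle t ht
  · exact (hm.const t ht).trans ((hle s le_rfl).trans (hm'.const t ht).symm)

/-- The delicate clause is `disj`, on which termination depends: a node must not be generated again
after its expansion. The clauses on coverage speak only of `SameVT`, so they survive the dropping of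
duplicates. -/
theorem Inv.of_expands (hσ : q.Inv I σ) (h : q.Expands I A σ σ') : q.Inv I σ' := by
  obtain ⟨fmin, n, htop, hgoal, hclosed, hopn, hdup⟩ := h
  have hn : n ∈ σ.opn := htop.2.1
  have hnwf := hσ.wf n (.inl hn)
  have hcl : ∀ m, m ∈ σ'.closed ↔ m = n ∨ m ∈ σ.closed := fun m => by rw [hclosed]; exact Iff.rfl
  have hmem : ∀ m ∈ σ'.opn ∪ σ'.closed, m ∈ σ.opn ∪ σ.closed ∨ m ∈ q.successors I n := by
    rintro m (hm | hm)
    · exact (hopn hm).imp (fun h => .inl h.1) id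
    · rcases (hcl m).1 hm with rfl | hm
      · exact .inl (.inl hn)
      · exact .inl (.inr hm)
  have hkeep : ∀ m ∈ σ.opn ∪ σ.closed, ∃ m' ∈ σ'.opn ∪ σ'.closed, m'.SameVT m := by
    rintro m (hm | hm)
    · by_cases hmn : m = n
      · exact ⟨m, .inr ((hcl m).2 (.inl hmn)), rfl, rfl⟩
      · exact hdup m (.inl ⟨hm, hmn⟩)
    · exact ⟨m, .inr ((hcl m).2 (.inr hm)), rfl, rfl⟩
  refine ⟨fun m hm => ?_, fun m hm hm' => ?_, fun m hm => ?_, fun m hm => ?_, fun h => ?_,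
    fun a ha m hm => ?_⟩
  · exact (hmem m hm).elim (hσ.wf m) hnwf.of_mem_successors
  · rcases hopn hm with hm | hm
    · rcases (hcl m).1 hm' with h | h
      · exact hm.2 h
      · exact hσ.disj m hm.1 h
    -- A successor of `n` that was already generated has a closed parent; parents are unique, so `n`
    -- itself would have been closed.
    · have hold : m ∈ σ.opn ∪ σ.closed := by
        rcases (hcl m).1 hm' with rfl | h
        · exact .inl hn
        · exact .inr h
      obtain ⟨u, -, -, -, hu⟩ := id hm
      rcases hσ.parent m hold with h | ⟨a, ha, hma⟩
      · rw [hu] at h; exact absurd h (Nat.succ_ne_zero _)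
      · have := (hσ.wf a (.inr ha)).parent_unique hnwf hma hm
        exact hσ.disj n hn (this ▸ ha)
  · rcases hmem m hm with h | h
    · exact (hσ.parent m h).imp id fun ⟨a, ha, hma⟩ => ⟨a, (hcl a).2 (.inr ha), hma⟩
    · exact .inr ⟨n, (hcl n).2 (.inl rfl), h⟩
  · rcases (hcl m).1 hm with rfl | h
    · exact hgoal
    · exact hσ.notGoal m h
  · obtain ⟨m, hm, hv, ht⟩ := hσ.start h
    obtain ⟨m', hm', hs⟩ := hkeep m hm
    exact ⟨m', hm', hs.1.trans hv, hs.2.trans ht⟩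
  · rcases (hcl a).1 ha with rfl | ha
    · exact hdup m (.inr hm)
    · obtain ⟨m₁, hm₁, hs₁⟩ := hσ.succ a ha m hm
      obtain ⟨m₂, hm₂, hs₂⟩ := hkeep m₁ hm₁
      exact ⟨m₂, hm₂, hs₂.1.trans hs₁.1, hs₂.2.trans hs₁.2⟩

/-- A node at the target is a goal if some trajectory that satisfies the constraints stays at the
target from the timestep of the node on. -/
theorem WellFormed.isGoal (hn : q.WellFormed I n) (hp : Satisfies q.cons p)
    (hv : n.vtx = I.target q.agent) (hstay : ∀ t, n.time ≤ t → p t = I.target q.agent) :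
    q.IsGoal I n := by
  refine ⟨hv, fun v t h => ?_, fun u v t h => ?_⟩
  · dsimp only
    split_ifs with ht
    · rintro rfl; exact hn.vertex t ht h
    · rw [← hstay t (by omega)]; exact hp.1 v t h
  · dsimp only
    rcases Nat.lt_or_ge t n.time with ht | ht
    · rw [if_pos ht.le, if_pos (show t + 1 ≤ n.time from ht)]
      rintro ⟨rfl, rfl⟩
      exact hn.edge t ht h
    · have h1 : (if t ≤ n.time then n.traj t else I.target q.agent) = p t := by
        rw [hstay t ht]
        split_ifs with h'
        · obtain rfl : t = n.time := by omega
          exact hv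
        · rfl
      rw [h1, if_neg (by omega), ← hstay (t + 1) (by omega)]
      exact hp.2 u v t h

/-- As long as focal search has not ended, some open node lies on any given path that satisfies
the constraints. -/
theorem Inv.exists_open (hσ : q.Inv I σ) (hp : I.IsPath q.agent p) (hs : Satisfies q.cons p) :
    ∃ m ∈ σ.opn, m.time ≤ I.pathCost q.agent p ∧ m.vtx = p m.time := by
  by_contra! hno
  -- Otherwise closed nodes follow `p` up to its cost, and the last of them is a closed goal. Their
  -- trajectories may differ from `p`: moves and constraints see only the current vertex and
  -- timestep.
  have key : ∀ t, t ≤ I.pathCost q.agent p → ∃ m ∈ σ.closed, m.vtx = p t ∧ m.time = t := by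
    intro t ht
    have hcl : (∃ m ∈ σ.opn ∪ σ.closed, m.vtx = p t ∧ m.time = t) →
        ∃ m ∈ σ.closed, m.vtx = p t ∧ m.time = t := by
      rintro ⟨m, hm | hm, hv, rfl⟩
      · exact absurd hv (hno m hm ht)
      · exact ⟨m, hm, hv, rfl⟩
    induction t with
    | zero =>
      apply hcl
      rw [hp.1]
      exact hσ.start fun h => hs.1 _ _ h hp.1
    | succ t ih =>
      obtain ⟨m, hm, hv, rfl⟩ := ih (by omega) (by
        rintro ⟨m, hm | hm, hv, rfl⟩
        · exact absurd hv (hno m hm (by omega))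
        · exact ⟨m, hm, hv, rfl⟩)
      apply hcl
      obtain ⟨m', hm', hs'⟩ := hσ.succ m hm (m.extend (p (m.time + 1)))
        ⟨p (m.time + 1), by rw [hv]; exact hp.2.1 _, fun h => hs.1 _ _ h rfl,
          fun h => hs.2 _ _ _ h ⟨hv.symm, rfl⟩, rfl⟩
      exact ⟨m', hm', hs'.1.trans (by simp [VTNode.vtx, VTNode.extend]), hs'.2⟩
  obtain ⟨m, hm, hv, ht⟩ := key _ le_rfl
  refine hσ.notGoal m hm ((hσ.wf m (.inr hm)).isGoal hs ?_ fun t h => ?_)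
  · rw [hv, hp.eq_target le_rfl]
  · exact hp.eq_target (ht ▸ h)

/-- Since `f` depends only on vertex and timestep, the open node lying on `p` has `f` at most the
cost of `p`. Admissibility suffices; the heuristic need not be consistent. -/
theorem Inv.fmin_le_pathCost (hh : I.Admissible A.h) (hσ : q.Inv I σ)
    (hmin : IsLeast (q.f A '' σ.opn) fmin) (hp : I.IsPath q.agent p) (hs : Satisfies q.cons p) :
    fmin ≤ I.pathCost q.agent p := by
  obtain ⟨m, hm, ht, hv⟩ := hσ.exists_open hp hs
  refine (hmin.2 ⟨m, hm, rfl⟩).trans ?_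
  rw [f, hv]
  exact hh _ _ p hp hs _ ht

theorem Inv.not_fails (hσ : q.Inv I σ) (hp : I.IsPath q.agent p) (hs : Satisfies q.cons p) :
    ¬ Fails σ := by
  intro h
  obtain ⟨m, hm, -⟩ := hσ.exists_open hp hs
  rw [Fails] at h
  simp [h] at hm

/-- A path found by focal search is a path that satisfies the constraints, its cost is within the
threshold, and the lower bound found is valid. -/
theorem Inv.finds_spec (hh : I.Admissible A.h) (hσ : q.Inv I σ) (h : q.Finds I A σ p b) :
    I.IsPath q.agent p ∧ Satisfies q.cons p ∧
      (I.pathCost q.agent p : ℝ) ≤ A.w * (b : ℝ) + q.flex ∧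
      ∀ r, I.IsPath q.agent r → Satisfies q.cons r → q.parentLB ≤ I.pathCost q.agent r →
        b ≤ I.pathCost q.agent r := by
  obtain ⟨fmin, n, ⟨hmin, hn, hthr, -⟩, ⟨hv, hsat⟩, rfl, rfl⟩ := h
  have hwf := hσ.wf n (.inl hn)
  refine ⟨⟨?_, fun t => ?_, n.time, fun t ht => ?_⟩, hsat, ?_,
    fun r hr hs hlb => max_le (hσ.fmin_le_pathCost hh hmin hr hs) hlb⟩
  · simpa using hwf.zero
  · dsimp only
    rcases Nat.lt_or_ge t n.time with ht | ht
    · rw [if_pos ht.le, if_pos (show t + 1 ≤ n.time from ht)]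
      exact hwf.move t ht
    · left
      rw [if_neg (by omega)]
      split_ifs with h'
      · obtain rfl : t = n.time := by omega
        exact hv.symm
      · rfl
  · dsimp only
    split_ifs with h'
    · obtain rfl : t = n.time := by omega
      exact hv
    · rfl
  -- The cost is at most `n.time`, which is at most `f n` because heuristic values are natural
  -- numbers.
  · refine le_trans ?_ hthr
    norm_cast
    refine le_trans (Instance.pathCost_le fun t ht => ?_) (Nat.le_add_right n.time _)
    split_ifs with h'
    · obtain rfl : t = n.time := by omega
      exact hv
    · rfl

/-- If FOCAL cannot be empty while OPEN is not, then focal search never gets stuck. -/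
theorem progress (hthr : ∀ fmin : ℕ, (fmin : ℝ) ≤ q.threshold A fmin) (σ : SearchState V) :
    Fails σ ∨ (∃ p b, q.Finds I A σ p b) ∨ ∃ σ', q.Expands I A σ σ' := by
  rcases σ.opn.eq_empty_or_nonempty with h | h
  · exact .inl h
  right
  have hne : (q.f A '' σ.opn).Nonempty := h.image _
  have hmin : IsLeast (q.f A '' σ.opn) (sInf (q.f A '' σ.opn)) :=
    ⟨Nat.sInf_mem hne, fun _ hx => Nat.sInf_le hx⟩
  set fmin := sInf (q.f A '' σ.opn)
  obtain ⟨n₀, hn₀, hf₀⟩ := hmin.1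
  let focal : Set (VTNode V) := {m | m ∈ σ.opn ∧ (q.f A m : ℝ) ≤ q.threshold A fmin}
  have hfocal : focal.Nonempty := ⟨n₀, hn₀, by rw [hf₀]; exact hthr _⟩
  obtain ⟨n, hn, hx⟩ : ∃ n ∈ focal, ∀ m ∈ focal, q.x n ≤ q.x m := by
    obtain ⟨n, hn, hnx⟩ := Nat.sInf_mem (hfocal.image q.x)
    exact ⟨n, hn, fun m hm => hnx ▸ Nat.sInf_le ⟨m, hm, rfl⟩⟩
  have htop : q.IsTop A σ fmin n := ⟨hmin, hn.1, hn.2, fun m hm hm' => hx m ⟨hm, hm'⟩⟩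
  by_cases hg : q.IsGoal I n
  · exact .inl ⟨_, _, fmin, n, htop, hg, rfl, rfl⟩
  · exact .inr ⟨⟨(σ.opn \ {n}) ∪ q.successors I n, insert n σ.closed⟩, fmin, n, htop, hg, rfl,
      subset_rfl, fun m hm => ⟨m, .inl hm, rfl, rfl⟩⟩

/-! ### Termination of focal search -/

/-- By `const`, such a node is determined by its timestep and its first `B + 1` positions. -/
theorem finite_wellFormed_time_le [Finite V] (B : ℕ) :
    {n : VTNode V | q.WellFormed I n ∧ n.time ≤ B}.Finite := by
  let g : VTNode V → ℕ × (Fin (B + 1) → V) := fun n => (n.time, fun t => n.traj t)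
  refine Set.Finite.of_finite_image (f := g)
    (((Set.finite_Iic B).prod (Set.finite_univ (α := Fin (B + 1) → V))).subset ?_) ?_
  · rintro _ ⟨n, hn, rfl⟩
    exact ⟨hn.2, trivial⟩
  · rintro ⟨s, r⟩ ⟨hwf, hs⟩ ⟨s', r'⟩ ⟨hwf', -⟩ h
    simp only [g, Prod.mk.injEq] at h
    obtain ⟨rfl, h⟩ := h
    have hle : ∀ t, t ≤ s → r t = r' t := fun t ht =>
      congrFun h ⟨t, Nat.lt_succ_of_le (ht.trans hs)⟩
    congr 1
    funext t
    rcases Nat.le_total t s with ht | ht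
    · exact hle t ht
    · exact (hwf.const t ht).trans ((hle s le_rfl).trans (hwf'.const t ht).symm)

/-- A node beyond the timesteps of all constraints can be completed to a path, if the target can
be reached from the start at all. -/
theorem WellFormed.exists_path (hn : q.WellFormed I n) (hp : I.IsPath q.agent p)
    (ht : ∀ ψ ∈ q.cons, ψ.time < n.time) : ∃ r, I.IsPath q.agent r ∧ Satisfies q.cons r := by
  have h1 : I.graph.Reachable (I.start q.agent) n.vtx :=
    hn.zero ▸ reachable_of_moves hn.move le_rfl
  have h2 : I.graph.Reachable (I.start q.agent) (I.target q.agent) := by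
    have := reachable_of_moves (G := I.graph) (r := p) (fun t _ => hp.2.1 t)
      (le_refl (I.pathCost q.agent p))
    rwa [hp.1, hp.eq_target le_rfl] at this
  -- The graph is undirected, so the agent can walk back to its start and on to the target; no
  -- constraint applies that late.
  obtain ⟨r, hr0, hrm, T, hrT⟩ := exists_trajectory (h1.symm.trans h2)
  have hle : ∀ t, t ≤ n.time →
      (fun t => if t ≤ n.time then n.traj t else r (t - n.time)) t = n.traj t :=
    fun t h => if_pos h
  have hge : ∀ t, n.time ≤ t →
      (fun t => if t ≤ n.time then n.traj t else r (t - n.time)) t = r (t - n.time) := by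
    intro t h
    dsimp only
    split_ifs with h'
    · obtain rfl : t = n.time := by omega
      rw [Nat.sub_self, hr0, VTNode.vtx]
    · rfl
  refine ⟨fun t => if t ≤ n.time then n.traj t else r (t - n.time),
    ⟨(hle 0 (Nat.zero_le _)).trans hn.zero, fun t => ?_, n.time + T, fun t h => ?_⟩,
    fun v t h => ?_, fun u v t h => ?_⟩
  · rcases Nat.lt_or_ge t n.time with h | h
    · rw [hle t h.le, hle (t + 1) h]; exact hn.move t h
    · rw [hge t h, hge (t + 1) (by omega), show t + 1 - n.time = t - n.time + 1 by omega]
      exact hrm _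
  · rw [hge t (by omega)]; exact hrT _ (by omega)
  · have h' : t < n.time := ht _ h
    rw [hle t h'.le]
    rintro rfl
    exact hn.vertex t h'.le h
  · have h' : t < n.time := ht _ h
    rw [hle t h'.le, hle (t + 1) h']
    rintro ⟨rfl, rfl⟩
    exact hn.edge t h' h

variable (I A q) in
/-- The nodes that focal search may take from FOCAL. -/
def searchSpace : Set (VTNode V) :=
  {n | ∃ σ fmin, q.Inv I σ ∧ q.IsTop A σ fmin n}

/-- It suffices to bound timesteps. A path obeying the constraints bounds `fmin`, hence the
threshold. If there is none, no node lies beyond the last constraint, since it could be completed to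
a path. The given `p` may violate the constraints; it only shows that the target is reachable. -/
theorem finite_searchSpace [Finite V] (hw : 1 ≤ A.w) (hh : I.Admissible A.h)
    (hp : I.IsPath q.agent p) : (q.searchSpace I A).Finite := by
  suffices h : ∃ B : ℕ, ∀ σ fmin n, q.Inv I σ → q.IsTop A σ fmin n → n.time ≤ B by
    obtain ⟨B, hB⟩ := h
    refine (q.finite_wellFormed_time_le (I := I) B).subset ?_
    rintro n ⟨σ, fmin, hσ, htop⟩
    exact ⟨hσ.wf n (.inl htop.2.1), hB σ fmin n hσ htop⟩
  by_cases hex : ∃ r, I.IsPath q.agent r ∧ Satisfies q.cons r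
  · obtain ⟨r, hr, hs⟩ := hex
    refine ⟨⌊A.w * ((max (I.pathCost q.agent r) q.parentLB : ℕ) : ℝ) + q.flex⌋₊,
      fun σ fmin n hσ ⟨hmin, _, hthr, _⟩ => Nat.le_floor ?_⟩
    have h1 : (n.time : ℝ) ≤ q.f A n := by
      exact_mod_cast Nat.le_add_right n.time _
    refine (h1.trans hthr).trans (add_le_add_left (mul_le_mul_of_nonneg_left ?_ (by linarith)) _)
    exact_mod_cast max_le_max_right _ (hσ.fmin_le_pathCost hh hmin hr hs)
  · refine ⟨q.cons.sup Constraint.time, fun σ fmin n hσ htop => ?_⟩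
    by_contra! hlt
    exact hex ((hσ.wf n (.inl htop.2.1)).exists_path hp fun ψ hψ =>
      (Finset.le_sup (f := Constraint.time) hψ).trans_lt hlt)

variable (I A q) in
/-- The number of nodes that focal search may still expand. -/
noncomputable def remaining (σ : SearchState V) : ℕ :=
  (q.searchSpace I A \ σ.closed).ncard

theorem remaining_lt [Finite V] (hw : 1 ≤ A.w) (hh : I.Admissible A.h)
    (hp : I.IsPath q.agent p) (hσ : q.Inv I σ) (h : q.Expands I A σ σ') :
    q.remaining I A σ' < q.remaining I A σ := by
  obtain ⟨fmin, n, htop, -, hclosed, -⟩ := h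
  refine Set.ncard_lt_ncard ?_ ((finite_searchSpace hw hh hp).subset Set.sdiff_subset)
  rw [hclosed]
  refine ⟨fun m hm => ⟨hm.1, fun h => hm.2 (.inr h)⟩, fun hsub => ?_⟩
  -- The expanded node is the one that leaves the count: by `disj` it was not closed before.
  exact (hsub ⟨⟨σ, fmin, hσ, htop⟩, hσ.disj n htop.2.1⟩).2 (.inl rfl)

end Query


/-! ### Conflicts -/

theorem VertexConflict.symm {V : Type*} {p q : ℕ → V} {t : ℕ} (h : VertexConflict p q t) :
    VertexConflict q p t :=
  Eq.symm h

theorem EdgeConflict.symm {V : Type*} {p q : ℕ → V} {t : ℕ} (h : EdgeConflict p q t) :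
    EdgeConflict q p t := by
  obtain ⟨h1, h2, h3⟩ := h
  exact ⟨by rw [h2, h3]; exact h1.symm, h3.symm, h2.symm⟩

theorem numConflicts_comm {V : Type*} (p q : ℕ → V) : numConflicts p q = numConflicts q p := by
  have h1 : {t | VertexConflict p q t} = {t | VertexConflict q p t} :=
    Set.ext fun t => ⟨.symm, .symm⟩
  have h2 : {t | EdgeConflict p q t} = {t | EdgeConflict q p t} :=
    Set.ext fun t => ⟨.symm, .symm⟩
  rw [numConflicts, numConflicts, h1, h2]

/-! ### Flex bounds and validity of constraint tree nodes -/

namespace CTNode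

variable {V : Type*} {k : ℕ} {I : Instance V k} {w : ℝ} {N : CTNode V k} {i : Fin k}

/-- In the sum over ordered pairs, the agents above `i` make up row `i`, and each `j` below `i`
contributes, by symmetry, one term of row `j`. -/
theorem agentConflicts_le_allConflicts (N : CTNode V k) (i : Fin k) :
    N.agentConflicts i ≤ N.allConflicts := by
  rw [agentConflicts, allConflicts, ← Finset.add_sum_erase _ _ (Finset.mem_univ i),
    ← Finset.sum_filter_add_sum_filter_not (Finset.univ.erase i) (fun j => i < j)]
  refine Nat.add_le_add (Finset.sum_le_sum_of_subset fun j hj => ?_) ?_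
  · exact Finset.mem_filter.2 ⟨Finset.mem_univ _, (Finset.mem_filter.1 hj).2⟩
  · refine le_trans (Finset.sum_le_sum fun j hj => ?_)
      (Finset.sum_le_sum_of_subset (Finset.filter_subset _ _))
    obtain ⟨hne, hlt⟩ := Finset.mem_filter.1 hj
    rw [numConflicts_comm]
    refine Finset.single_le_sum (f := fun l => numConflicts (N.path j) (N.path l))
      (fun _ _ => Nat.zero_le _) (Finset.mem_filter.2 ⟨Finset.mem_univ _, ?_⟩)
    exact lt_of_le_of_ne (not_lt.1 hlt) (Finset.ne_of_mem_erase hne)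

theorem conflictShare_nonneg (N : CTNode V k) (i : Fin k) : 0 ≤ N.conflictShare i :=
  div_nonneg (Nat.cast_nonneg _) (Nat.cast_nonneg _)

theorem conflictShare_le_one (N : CTNode V k) (i : Fin k) : N.conflictShare i ≤ 1 :=
  div_le_one_of_le₀ (by exact_mod_cast N.agentConflicts_le_allConflicts i) (Nat.cast_nonneg _)

/-- This is all that the proof uses about CFD and DFD. For Δ_max ≥ 0, DFD is a convex combination of
Δ_d and Δ_max, both in [0, Δ_max]. -/
theorem flex_mem_Icc {A : Params V k} (hdelay : ∀ (Nhat : CTNode V k) (i : Fin k)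
      (Ψ : Finset (Constraint V)), 0 ≤ ∑ ψ ∈ Ψ, A.delay Nhat i Ψ ψ)
    (N : CTNode V k) (i : Fin k) (Ψ : Finset (Constraint V)) :
    A.flex I N i Ψ ∈ Set.Icc (min 0 (N.maxFlex I A.w i)) (N.maxFlex I A.w i) := by
  have h0 := N.conflictShare_nonneg i
  have h1 := N.conflictShare_le_one i
  rw [Params.flex]
  rcases A.mechanism N i Ψ with _ | _
  · simp only [flexCFD]
    split_ifs with h
    · rw [min_eq_left h]
      exact ⟨mul_nonneg h0 h, mul_le_of_le_one_left h h1⟩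
    · exact ⟨min_le_right _ _, le_rfl⟩
  · simp only [flexDFD]
    split_ifs with h
    · rw [min_eq_left h]
      have hd0 : 0 ≤ N.delayFlex I A.w i (∑ ψ ∈ Ψ, A.delay N i Ψ ψ) := le_min h (hdelay N i Ψ)
      have hd1 : 0 ≤ N.maxFlex I A.w i - N.delayFlex I A.w i (∑ ψ ∈ Ψ, A.delay N i Ψ ψ) :=
        sub_nonneg.2 (min_le_left _ _)
      have h2 := mul_nonneg h0 hd1
      have h3 := mul_le_of_le_one_left hd1 h1
      constructor <;> linarith
    · exact ⟨min_le_right _ _, le_rfl⟩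

/-- Δ_max is the slack w·LB − C of the whole node without the agent's own share, which links flex to
`Valid.cost_le`. -/
theorem maxFlex_eq (N : CTNode V k) (i : Fin k) :
    N.maxFlex I w i = (w * (N.totalLB : ℝ) - (N.totalCost I : ℝ)) -
      (w * (N.lb i : ℝ) - (N.cost I i : ℝ)) := by
  have h : ∑ j, (w * (N.lb j : ℝ) - (N.cost I j : ℝ)) =
      w * (N.totalLB : ℝ) - (N.totalCost I : ℝ) := by
    rw [Finset.sum_sub_distrib, ← Finset.mul_sum, totalLB, totalCost]
    push_cast
    rfl
  rw [maxFlex, ← h, ← Finset.add_sum_erase _ _ (Finset.mem_univ i)]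
  ring

/-- What EECBS maintains for all generated CT nodes: the paths satisfy the constraints, the lower
bounds are valid, and the node is bounded-suboptimal with respect to its own lower bound. -/
structure Valid (I : Instance V k) (w : ℝ) (N : CTNode V k) : Prop where
  isPath : ∀ i, I.IsPath i (N.path i)
  sat : ∀ i, Satisfies (N.cons i) (N.path i)
  lb_le : ∀ i p, I.IsPath i p → Satisfies (N.cons i) p → N.lb i ≤ I.pathCost i p
  cost_le : (N.totalCost I : ℝ) ≤ w * (N.totalLB : ℝ)

theorem subset_childCons (N : CTNode V k) (i : Fin k) (ψ : Constraint V) :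
    N.cons i ⊆ N.childCons i ψ := by
  classical
  intro φ h
  simp [childCons, h]

theorem mem_childCons {φ ψ : Constraint V} :
    φ ∈ N.childCons i ψ ↔ φ = ψ ∨ φ ∈ N.cons i := by
  simp [childCons]

theorem card_childCons {ψ : Constraint V} (h : ψ ∉ N.cons i) :
    (N.childCons i ψ).card = (N.cons i).card + 1 := by
  classical
  exact Finset.card_insert_of_notMem h

variable {A : Params V k} {ψ : Constraint V}

/-- FOCAL is nonempty whenever OPEN is. -/
theorem Valid.le_threshold (hw : 1 ≤ A.w) (hdelay : ∀ (Nhat : CTNode V k) (i : Fin k)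
      (Ψ : Finset (Constraint V)), 0 ≤ ∑ ψ ∈ Ψ, A.delay Nhat i Ψ ψ)
    (hN : N.Valid I A.w) (i : Fin k) (ψ : Constraint V) (fmin : ℕ) :
    (fmin : ℝ) ≤ (childQuery A I N i ψ).threshold A fmin := by
  have hlb : (N.lb i : ℝ) ≤ N.cost I i := by
    exact_mod_cast hN.lb_le i _ (hN.isPath i) (hN.sat i)
  have hflex := (flex_mem_Icc (I := I) hdelay N i (N.childCons i ψ)).1
  have hmax := maxFlex_eq (I := I) (w := A.w) N i
  have hcost := hN.cost_le
  have h1 : (fmin : ℝ) ≤ ((max fmin (N.lb i) : ℕ) : ℝ) := by exact_mod_cast le_max_left _ _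
  have h2 : (N.lb i : ℝ) ≤ ((max fmin (N.lb i) : ℕ) : ℝ) := by exact_mod_cast le_max_right _ _
  have h0 : (0 : ℝ) ≤ fmin := Nat.cast_nonneg _
  change _ ≤ A.w * ((max fmin (N.lb i) : ℕ) : ℝ) + A.flex I N i (N.childCons i ψ)
  generalize ((max fmin (N.lb i) : ℕ) : ℝ) = m at *
  rcases min_le_iff.1 hflex with h | h
  · nlinarith
  -- Here flex ≥ Δ_max ≥ c_i − w·lb_i ≥ (1 − w)·lb_i, so the threshold is at least w·m − (w −
  -- 1)·lb_i ≥ m, as lb_i ≤ m.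
  · nlinarith [mul_nonneg (sub_nonneg.2 hw) (sub_nonneg.2 h2)]

theorem child_cons_self (N : CTNode V k) (p : ℕ → V) (b : ℕ) :
    (N.child i ψ p b).cons i = N.childCons i ψ := by
  simp [child]

theorem child_cons_of_ne {j : Fin k} (h : j ≠ i) (N : CTNode V k) (p : ℕ → V) (b : ℕ) :
    (N.child i ψ p b).cons j = N.cons j := by
  simp [child, h]

/-- The parent's lower bound stays correct because constraints are only added. The cost bound holds
because the new path costs at most w·b + Δ_max. -/
theorem Valid.child (hh : I.Admissible A.h) (hdelay : ∀ (Nhat : CTNode V k) (i : Fin k)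
      (Ψ : Finset (Constraint V)), 0 ≤ ∑ ψ ∈ Ψ, A.delay Nhat i Ψ ψ)
    (hN : N.Valid I A.w) {σ : SearchState V} {p : ℕ → V} {b : ℕ}
    (hσ : (childQuery A I N i ψ).Inv I σ) (hf : (childQuery A I N i ψ).Finds I A σ p b) :
    (N.child i ψ p b).Valid I A.w := by
  obtain ⟨hp, hs, hc, hb⟩ := hσ.finds_spec hh hf
  change I.IsPath i p at hp
  change Satisfies (N.childCons i ψ) p at hs
  change (I.pathCost i p : ℝ) ≤ A.w * b + A.flex I N i (N.childCons i ψ) at hc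
  refine ⟨fun j => ?_, fun j => ?_, fun j r hr hrs => ?_, ?_⟩
  · rcases eq_or_ne j i with rfl | h
    · simpa [CTNode.child] using hp
    · simpa [CTNode.child, h] using hN.isPath j
  · rcases eq_or_ne j i with rfl | h
    · simpa [CTNode.child] using hs
    · simpa [CTNode.child, h] using hN.sat j
  · rcases eq_or_ne j i with rfl | h
    · rw [child_cons_self] at hrs
      simp only [CTNode.child, Function.update_self]
      exact hb r hr hrs (hN.lb_le _ r hr (hrs.mono (N.subset_childCons _ ψ)))
    · rw [child_cons_of_ne h] at hrs
      simpa [CTNode.child, h] using hN.lb_le j r hr hrs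
  · have hsum : 0 ≤ (N.child i ψ p b).maxFlex I A.w i +
        (A.w * ((N.child i ψ p b).lb i : ℝ) - ((N.child i ψ p b).cost I i : ℝ)) := by
      -- Δ_max involves only the other agents, and these are unchanged in the child.
      have hM : (N.child i ψ p b).maxFlex I A.w i = N.maxFlex I A.w i :=
        Finset.sum_congr rfl fun j hj => by
          simp [CTNode.child, cost, Finset.ne_of_mem_erase hj]
      have h2 := (flex_mem_Icc (I := I) hdelay N i (N.childCons i ψ)).2
      rw [hM]
      simp only [CTNode.child, cost, Function.update_self]
      linarith
    rw [maxFlex_eq] at hsum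
    linarith

/-! ### Branching on a conflict -/

/-- `N` does not exclude the paths `Q`. -/
def Permits (N : CTNode V k) (Q : Fin k → ℕ → V) : Prop :=
  ∀ i, Satisfies (N.cons i) (Q i)

theorem Permits.child {Q : Fin k → ℕ → V} (hN : N.Permits Q)
    (h : Satisfies (N.childCons i ψ) (Q i)) (p : ℕ → V) (b : ℕ) :
    (N.child i ψ p b).Permits Q := by
  intro j
  rcases eq_or_ne j i with rfl | hj
  · rwa [child_cons_self]
  · rw [child_cons_of_ne hj]; exact hN j

theorem satisfies_childCons {Q : ℕ → V} : Satisfies (N.childCons i ψ) Q ↔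
    Satisfies {ψ} Q ∧ Satisfies (N.cons i) Q := by
  simp only [Satisfies, mem_childCons, Finset.mem_singleton]
  grind

/-- A conflict-free set of paths respects one of the two constraints that resolve a conflict. -/
theorem Conflict.satisfies_or {j : Fin k} {ψi ψj : Constraint V} (hc : N.Conflict i ψi j ψj)
    {Q : Fin k → ℕ → V} (hQ : I.IsSolution Q) :
    Satisfies {ψi} (Q i) ∨ Satisfies {ψj} (Q j) := by
  cases hc with
  | vertex _ t hij hc =>
    -- If `Q` broke both constraints, it would reproduce the conflict of `N` between the same two
    -- agents.
    by_contra! h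
    have hi : Q i t = N.path i t := by
      by_contra hne
      exact h.1 ⟨fun v s hs => by simp_all, fun u v s hs => by simp at hs⟩
    have hj : Q j t = N.path j t := by
      by_contra hne
      exact h.2 ⟨fun v s hs => by simp_all, fun u v s hs => by simp at hs⟩
    exact (hQ.2 i j hij t).1 (hi.trans (Eq.trans hc hj.symm))
  | edge _ t hij hc =>
    by_contra! h
    have hi : Q i t = N.path i t ∧ Q i (t + 1) = N.path i (t + 1) := by
      by_contra hne
      refine h.1 ⟨fun v s hs => by simp at hs, fun u v s hs => ?_⟩
      simp only [Finset.mem_singleton, Constraint.edge.injEq] at hs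
      obtain ⟨rfl, rfl, rfl⟩ := hs
      exact hne
    have hj : Q j t = N.path j t ∧ Q j (t + 1) = N.path j (t + 1) := by
      by_contra hne
      refine h.2 ⟨fun v s hs => by simp at hs, fun u v s hs => ?_⟩
      simp only [Finset.mem_singleton, Constraint.edge.injEq] at hs
      obtain ⟨rfl, rfl, rfl⟩ := hs
      exact hne
    refine (hQ.2 i j hij t).2 ?_
    rw [EdgeConflict, hi.1, hi.2, hj.1, hj.2]
    exact hc

theorem Conflict.symm {j : Fin k} {ψi ψj : Constraint V} (hc : N.Conflict i ψi j ψj) :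
    N.Conflict j ψj i ψi := by
  cases hc with
  | vertex _ t hij hc => exact .vertex _ _ t hij.symm hc.symm
  | edge _ t hij hc => exact .edge _ _ t hij.symm hc.symm

/-- The constraint forbids what the current path does, while that path obeys all constraints
present. -/
theorem Conflict.notMem {j : Fin k} {ψi ψj : Constraint V} (hc : N.Conflict i ψi j ψj)
    (hN : N.Valid I w) : ψi ∉ N.cons i := by
  cases hc with
  | vertex _ t hij hc => exact fun h => (hN.sat i).1 _ _ h rfl
  | edge _ t hij hc => exact fun h => (hN.sat i).2 _ _ _ h ⟨rfl, rfl⟩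

theorem cost_le_totalCost (N : CTNode V k) (i : Fin k) : N.cost I i ≤ N.totalCost I :=
  Finset.single_le_sum (fun _ _ => Nat.zero_le _) (Finset.mem_univ i)

/-- Conflicts occur before all agents have reached their targets. -/
theorem Conflict.time_le {j : Fin k} {ψi ψj : Constraint V} (hc : N.Conflict i ψi j ψj)
    (hN : N.Valid I w) : ψi.time ≤ N.totalCost I := by
  have htarget : ∀ l t, N.totalCost I < t → N.path l t = I.target l := fun l t ht =>
    (hN.isPath l).eq_target ((N.cost_le_totalCost l).trans ht.le)
  by_contra! hlt
  cases hc with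
  | vertex _ t hij hc =>
    have hc : N.path i t = N.path j t := hc
    rw [htarget i t hlt, htarget j t hlt] at hc
    exact hij (I.target_injective hc)
  | edge _ t hij hc =>
    exact hc.1 ((htarget i t hlt).trans (htarget i _ (Nat.lt_succ_of_lt hlt)).symm)

theorem isSolution_of_no_conflict (hN : N.Valid I w)
    (h : ¬ ∃ i ψi j ψj, N.Conflict i ψi j ψj) : I.IsSolution N.path :=
  ⟨hN.isPath, fun i j hij t =>
    ⟨fun hc => h ⟨_, _, _, _, .vertex i j t hij hc⟩, fun hc => h ⟨_, _, _, _, .edge i j t hij hc⟩⟩⟩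

theorem Permits.totalLB_le {Q : Fin k → ℕ → V} (hN : N.Valid I w) (hP : N.Permits Q)
    (hQ : I.IsSolution Q) : N.totalLB ≤ I.soc Q :=
  Finset.sum_le_sum fun i _ => hN.lb_le i _ (hQ.1 i) (hP i)

/-- The number of constraints of a CT node. -/
def size (N : CTNode V k) : ℕ :=
  ∑ i, (N.cons i).card

/-- Phrased without `child`, so that it applies before a path and a lower bound for the child exist.
-/
theorem sum_card_update (N : CTNode V k) (h : ψ ∉ N.cons i) :
    ∑ j, (Function.update N.cons i (N.childCons i ψ) j).card = N.size + 1 := by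
  rw [size, ← Finset.add_sum_erase _ _ (Finset.mem_univ i),
    ← Finset.add_sum_erase (a := i) _ (fun j => (N.cons j).card) (Finset.mem_univ i),
    Function.update_self, card_childCons h,
    Finset.sum_congr rfl fun j hj => by rw [Function.update_of_ne (Finset.ne_of_mem_erase hj)]]
  ring

theorem size_child (h : ψ ∉ N.cons i) (p : ℕ → V) (b : ℕ) :
    (N.child i ψ p b).size = N.size + 1 :=
  N.sum_card_update h

variable (k) in
/-- The maximal number of constraints of a CT node with constraints at timesteps up to `B`. -/
noncomputable def maxSize (V : Type*) (B : ℕ) : ℕ :=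
  k * {ψ : Constraint V | ψ.time ≤ B}.ncard

/-- Strict because the family enlarged by `ψ` still fits within the bound. -/
theorem size_lt_maxSize [Finite V] {B : ℕ} (hN : ∀ j, ∀ φ ∈ N.cons j, φ.time ≤ B)
    (h : ψ ∉ N.cons i) (hψ : ψ.time ≤ B) : N.size < maxSize k V B := by
  rw [← Nat.succ_le_iff, Nat.succ_eq_add_one, ← N.sum_card_update h, maxSize]
  refine (Finset.sum_le_card_nsmul _ _ {ψ : Constraint V | ψ.time ≤ B}.ncard
    fun j _ => ?_).trans (by simp)
  rw [← Set.ncard_coe_finset]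
  refine Set.ncard_le_ncard (fun φ hφ => ?_) (finite_constraint_time_le B)
  rcases eq_or_ne j i with rfl | hj
  · rw [Function.update_self, Finset.mem_coe, mem_childCons] at hφ
    rcases hφ with rfl | hφ
    · exact hψ
    · exact hN _ _ hφ
  · rw [Function.update_of_ne hj] at hφ
    exact hN _ _ hφ

end CTNode


variable {V : Type*} {k : ℕ} {I : Instance V k} {A : Params V k}

theorem globalLB_le {L : Multiset (CTNode V k)} {N : CTNode V k} (h : N ∈ L) :
    globalLB L ≤ N.totalLB :=
  Nat.sInf_le ⟨N, h, rfl⟩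

theorem exists_totalLB_eq_globalLB {L : Multiset (CTNode V k)} (h : L ≠ 0) :
    ∃ N ∈ L, N.totalLB = globalLB L := by
  obtain ⟨N, hN⟩ := Multiset.exists_mem_of_ne_zero h
  exact Nat.sInf_mem (s := {b | ∃ N ∈ L, N.totalLB = b}) ⟨_, N, hN, rfl⟩

/-! ### Root of the constraint tree -/

/-- The paths and lower bounds found so far for the root are correct. -/
def PlanValid (I : Instance V k) (w : ℝ) (plan : Fin k → Option ((ℕ → V) × ℕ)) : Prop :=
  ∀ i p b, plan i = some (p, b) → I.IsPath i p ∧ (∀ r, I.IsPath i r → b ≤ I.pathCost i r) ∧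
    (I.pathCost i p : ℝ) ≤ w * (b : ℝ)

theorem satisfies_empty (p : ℕ → V) : Satisfies ∅ p :=
  ⟨fun _ _ h => by simp at h, fun _ _ _ h => by simp at h⟩

theorem le_threshold_rootQuery (hw : 1 ≤ A.w) (plan : Fin k → Option ((ℕ → V) × ℕ)) (i : Fin k)
    (fmin : ℕ) : (fmin : ℝ) ≤ (rootQuery plan i).threshold A fmin := by
  change _ ≤ A.w * ((max fmin 0 : ℕ) : ℝ) + 0
  rw [Nat.max_zero, add_zero]
  exact le_mul_of_one_le_left (Nat.cast_nonneg _) hw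

theorem PlanValid.update (hh : I.Admissible A.h) {plan : Fin k → Option ((ℕ → V) × ℕ)}
    (hplan : PlanValid I A.w plan) {i : Fin k} {σ : SearchState V} {p : ℕ → V} {b : ℕ}
    (hσ : (rootQuery plan i).Inv I σ) (hf : (rootQuery plan i).Finds I A σ p b) :
    PlanValid I A.w (Function.update plan i (some (p, b))) := by
  intro j r c hj
  rcases eq_or_ne j i with rfl | hne
  · rw [Function.update_self, Option.some_inj, Prod.mk.injEq] at hj
    obtain ⟨rfl, rfl⟩ := hj
    obtain ⟨hp, -, hc, hb⟩ := hσ.finds_spec hh hf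
    exact ⟨hp, fun r hr => hb r hr (satisfies_empty r) (Nat.zero_le _), by
      simpa [rootQuery] using hc⟩
  · rw [Function.update_of_ne hne] at hj
    exact hplan j r c hj

theorem PlanValid.valid_root {P : Fin k → ℕ → V} {b : Fin k → ℕ} {w : ℝ}
    (h : PlanValid I w fun i => some (P i, b i)) :
    (⟨fun _ => ∅, P, b⟩ : CTNode V k).Valid I w := by
  refine ⟨fun i => (h i _ _ rfl).1, fun i => satisfies_empty _,
    fun i r hr _ => (h i _ _ rfl).2.1 r hr, ?_⟩
  rw [CTNode.totalCost, CTNode.totalLB]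
  push_cast
  rw [Finset.mul_sum]
  exact Finset.sum_le_sum fun i _ => (h i _ _ rfl).2.2

/-! ### Invariants of EECBS -/

namespace State

/-- Everything generated is valid, and what is returned is a solution. -/
def Sound (I : Instance V k) (A : Params V k) : State V k → Prop
  | .root plan => PlanValid I A.w plan
  | .rootSearch plan i σ => PlanValid I A.w plan ∧ (rootQuery plan i).Inv I σ ∧ plan i = none
  | .main L => ∀ N ∈ L, N.Valid I A.w
  | .expand L N todo =>
      (∀ N' ∈ L, N'.Valid I A.w) ∧ N.Valid I A.w ∧ ∀ x ∈ todo, x.2 ∉ N.cons x.1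
  | .childSearch L N todo i ψ σ =>
      (∀ N' ∈ L, N'.Valid I A.w) ∧ N.Valid I A.w ∧ (∀ x ∈ (i, ψ) :: todo, x.2 ∉ N.cons x.1) ∧
        (childQuery A I N i ψ).Inv I σ
  | .solved P => I.IsSolution P
  | .failed => True

/-- No solution is presupposed here, so a returned result is a solution on every instance. -/
theorem Sound.step (hh : I.Admissible A.h) (hdelay : ∀ (Nhat : CTNode V k) (i : Fin k)
      (Ψ : Finset (Constraint V)), 0 ≤ ∑ ψ ∈ Ψ, A.delay Nhat i Ψ ψ)
    {s s' : State V k} (hs : s.Sound I A) (h : Step I A s s') : s'.Sound I A := by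
  cases h with
  | rootStart plan i hi => exact ⟨hs, Query.inv_initialState, hi⟩
  | rootExpands plan i σ σ' h => exact ⟨hs.1, hs.2.1.of_expands h, hs.2.2⟩
  | rootFinds plan i σ p b h => exact hs.1.update hh hs.2.1 h
  | rootFails => trivial
  | rootDone P b =>
    intro N hN
    obtain rfl := Multiset.mem_singleton.1 hN
    exact PlanValid.valid_root hs
  | exhausted => trivial
  | returns L N hsel hno =>
    exact CTNode.isSolution_of_no_conflict (hs N (Multiset.mem_cons_self _ _)) hno
  | expands L N hsel i j ψi ψj hconf =>
    have hN := hs N (Multiset.mem_cons_self _ _)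
    refine ⟨fun N' h => hs N' (Multiset.mem_cons_of_mem h), hN, fun x hx => ?_⟩
    simp only [List.mem_cons, List.not_mem_nil, or_false] at hx
    rcases hx with rfl | rfl
    · exact hconf.notMem hN
    · exact hconf.symm.notMem hN
  | expandDone L N => exact hs.1
  | childStart L N i ψ todo => exact ⟨hs.1, hs.2.1, hs.2.2, Query.inv_initialState⟩
  | childExpands L N todo i ψ σ σ' h => exact ⟨hs.1, hs.2.1, hs.2.2.1, hs.2.2.2.of_expands h⟩
  | childFinds L N todo i ψ σ p b h =>
    obtain ⟨h1, h2, h3, h4⟩ := hs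
    refine ⟨fun N' hN' => ?_, h2, fun x hx => h3 x (List.mem_cons_of_mem _ hx)⟩
    rcases Multiset.mem_cons.1 hN' with rfl | hN'
    · exact h2.child hh hdelay h4 h
    · exact h1 N' hN'
  | childFails L N todo i ψ σ h =>
    exact ⟨hs.1, hs.2.1, fun x hx => hs.2.2.1 x (List.mem_cons_of_mem _ hx)⟩

/-- All constraints of the generated nodes concern timesteps up to `B`. -/
def Bounded (B : ℕ) : State V k → Prop
  | .main L => ∀ N ∈ L, ∀ j, ∀ φ ∈ N.cons j, φ.time ≤ B
  | .expand L N todo =>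
      (∀ N' ∈ L, ∀ j, ∀ φ ∈ N'.cons j, φ.time ≤ B) ∧ (∀ j, ∀ φ ∈ N.cons j, φ.time ≤ B) ∧
        ∀ x ∈ todo, x.2.time ≤ B
  | .childSearch L N todo i ψ _ =>
      (∀ N' ∈ L, ∀ j, ∀ φ ∈ N'.cons j, φ.time ≤ B) ∧ (∀ j, ∀ φ ∈ N.cons j, φ.time ≤ B) ∧
        ∀ x ∈ (i, ψ) :: todo, x.2.time ≤ B
  | _ => True

/-- Some generated node, or some child that is still to be generated, permits `Q`. -/
def Pending (Q : Fin k → ℕ → V) (L : Multiset (CTNode V k)) (N : CTNode V k)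
    (todo : List (Fin k × Constraint V)) : Prop :=
  (∃ N' ∈ L, N'.Permits Q) ∨
    (N.Permits Q ∧ ∃ x ∈ todo, Satisfies (N.childCons x.1 x.2) (Q x.1))

/-- The solution `Q` has not been lost, and what is returned is not much worse than `Q`. -/
def Covers (I : Instance V k) (w : ℝ) (Q : Fin k → ℕ → V) : State V k → Prop
  | .root _ => True
  | .rootSearch _ _ _ => True
  | .main L => ∃ N ∈ L, N.Permits Q
  | .expand L N todo => Pending Q L N todo
  | .childSearch L N todo i ψ _ => Pending Q L N ((i, ψ) :: todo)
  | .solved P => (I.soc P : ℝ) ≤ w * (I.soc Q : ℝ)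
  | .failed => False

variable {Q : Fin k → ℕ → V} {s s' : State V k}

/-- Serves twice: for a returned node it is the quality guarantee, for an expanded one it limits
when conflicts can occur. -/
theorem totalCost_le (hw : 1 ≤ A.w) (hQ : I.IsSolution Q) {L : Multiset (CTNode V k)}
    {N : CTNode V k} (hsel : (N.totalCost I : ℝ) ≤ A.w * (globalLB L : ℝ))
    (hs : (State.main L).Sound I A) (hc : (State.main L).Covers I A.w Q) :
    (N.totalCost I : ℝ) ≤ A.w * (I.soc Q : ℝ) := by
  obtain ⟨N', hN', hP⟩ := hc
  refine hsel.trans (mul_le_mul_of_nonneg_left ?_ (by linarith))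
  exact_mod_cast (globalLB_le hN').trans (hP.totalLB_le (hs N' hN') hQ)

/-- A node permitting `Q` disappears only by expansion. One of its two children then permits `Q`,
and the search for that child cannot fail, since the path in `Q` is available. -/
theorem Covers.step (hw : 1 ≤ A.w) (hQ : I.IsSolution Q) (hs : s.Sound I A)
    (hc : s.Covers I A.w Q) (h : Step I A s s') : s'.Covers I A.w Q := by
  cases h with
  | rootStart plan i hi => trivial
  | rootExpands plan i σ σ' h => trivial
  | rootFinds plan i σ p b h => trivial
  | rootFails plan i σ h =>
    exact hs.2.1.not_fails (hQ.1 i) (satisfies_empty _) h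
  | rootDone P b => exact ⟨_, Multiset.mem_singleton_self _, fun i => satisfies_empty _⟩
  | exhausted =>
    obtain ⟨N, hN, -⟩ := hc
    exact absurd hN (Multiset.notMem_zero _)
  | returns L N hsel hno => exact totalCost_le hw hQ hsel hs hc
  | expands L N hsel i j ψi ψj hconf =>
    obtain ⟨N', hN', hP⟩ := hc
    rcases Multiset.mem_cons.1 hN' with rfl | hN'
    · refine .inr ⟨hP, ?_⟩
      rcases hconf.satisfies_or hQ with h | h
      · exact ⟨(i, ψi), by simp, CTNode.satisfies_childCons.2 ⟨h, hP i⟩⟩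
      · exact ⟨(j, ψj), by simp, CTNode.satisfies_childCons.2 ⟨h, hP j⟩⟩
    · exact .inl ⟨N', hN', hP⟩
  | expandDone L N =>
    rcases hc with hc | ⟨-, x, hx, -⟩
    · exact hc
    · exact absurd hx List.not_mem_nil
  | childStart L N i ψ todo => exact hc
  | childExpands L N todo i ψ σ σ' h => exact hc
  | childFinds L N todo i ψ σ p b h =>
    rcases hc with ⟨N', hN', hP⟩ | ⟨hP, x, hx, hsat⟩
    · exact .inl ⟨N', Multiset.mem_cons_of_mem hN', hP⟩
    · rcases List.mem_cons.1 hx with rfl | hx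
      · exact .inl ⟨_, Multiset.mem_cons_self _ _, hP.child hsat p b⟩
      · exact .inr ⟨hP, x, hx, hsat⟩
  | childFails L N todo i ψ σ h =>
    rcases hc with hc | ⟨hP, x, hx, hsat⟩
    · exact .inl hc
    · rcases List.mem_cons.1 hx with rfl | hx
      · exact absurd h (hs.2.2.2.not_fails (hQ.1 _) hsat)
      · exact .inr ⟨hP, x, hx, hsat⟩

theorem Bounded.step (hw : 1 ≤ A.w) (hQ : I.IsSolution Q) (hs : s.Sound I A)
    (hc : s.Covers I A.w Q) (hb : s.Bounded ⌊A.w * (I.soc Q : ℝ)⌋₊) (h : Step I A s s') :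
    s'.Bounded ⌊A.w * (I.soc Q : ℝ)⌋₊ := by
  cases h with
  | rootStart plan i hi => trivial
  | rootExpands plan i σ σ' h => trivial
  | rootFinds plan i σ p b h => trivial
  | rootFails plan i σ h => trivial
  | rootDone P b =>
    intro N hN j φ hφ
    obtain rfl := Multiset.mem_singleton.1 hN
    simp at hφ
  | exhausted => trivial
  | returns L N hsel hno => trivial
  | expands L N hsel i j ψi ψj hconf =>
    have hN := hs N (Multiset.mem_cons_self _ _)
    have hcost : N.totalCost I ≤ ⌊A.w * (I.soc Q : ℝ)⌋₊ :=
      Nat.le_floor (totalCost_le hw hQ hsel hs hc)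
    refine ⟨fun N' h => hb N' (Multiset.mem_cons_of_mem h), hb N (Multiset.mem_cons_self _ _),
      fun x hx => ?_⟩
    simp only [List.mem_cons, List.not_mem_nil, or_false] at hx
    rcases hx with rfl | rfl
    · exact (hconf.time_le hN).trans hcost
    · exact (hconf.symm.time_le hN).trans hcost
  | expandDone L N => exact hb.1
  | childStart L N i ψ todo => exact hb
  | childExpands L N todo i ψ σ σ' h => exact hb
  | childFinds L N todo i ψ σ p b h =>
    obtain ⟨h1, h2, h3⟩ := hb
    refine ⟨fun N' hN' => ?_, h2, fun x hx => h3 x (List.mem_cons_of_mem _ hx)⟩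
    rcases Multiset.mem_cons.1 hN' with rfl | hN'
    · intro j φ hφ
      rcases eq_or_ne j i with rfl | hj
      · rw [CTNode.child_cons_self, CTNode.mem_childCons] at hφ
        rcases hφ with rfl | hφ
        · exact h3 _ List.mem_cons_self
        · exact h2 _ φ hφ
      · rw [CTNode.child_cons_of_ne hj] at hφ
        exact h2 _ φ hφ
    · exact h1 N' hN'
  | childFails L N todo i ψ σ h =>
    exact ⟨hb.1, hb.2.1, fun x hx => hb.2.2 x (List.mem_cons_of_mem _ hx)⟩

/-! ### Progress and termination -/

/-- EECBS never gets stuck before it has returned a solution or reported failure. -/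
theorem Sound.progress (hw : 1 ≤ A.w) (hdelay : ∀ (Nhat : CTNode V k) (i : Fin k)
      (Ψ : Finset (Constraint V)), 0 ≤ ∑ ψ ∈ Ψ, A.delay Nhat i Ψ ψ)
    (hs : s.Sound I A) : (∃ s', Step I A s s') ∨ (∃ P, s = .solved P) ∨ s = .failed := by
  rcases s with plan | ⟨plan, i, σ⟩ | L | ⟨L, N, _ | ⟨⟨i, ψ⟩, todo⟩⟩ | ⟨L, N, todo, i, ψ, σ⟩ | P | _
  · left
    by_cases h : ∃ i, plan i = none
    · obtain ⟨i, hi⟩ := h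
      exact ⟨_, .rootStart plan i hi⟩
    · push Not at h
      choose x hx using fun i => Option.ne_none_iff_exists'.1 (h i)
      obtain rfl : plan = fun i => some ((x i).1, (x i).2) := funext hx
      exact ⟨_, .rootDone (fun i => (x i).1) (fun i => (x i).2)⟩
  · left
    rcases Query.progress (I := I) (le_threshold_rootQuery hw plan i) σ with
      h | ⟨p, b, h⟩ | ⟨σ', h⟩
    · exact ⟨_, .rootFails plan i σ h⟩
    · exact ⟨_, .rootFinds plan i σ p b h⟩
    · exact ⟨_, .rootExpands plan i σ σ' h⟩
  · left
    rcases eq_or_ne L 0 with rfl | hL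
    · exact ⟨_, .exhausted⟩
    -- A node of least LB is selectable by its own bound `cost_le`.
    · obtain ⟨N, hN, hlb⟩ := exists_totalLB_eq_globalLB hL
      have hsel : (N.totalCost I : ℝ) ≤ A.w * (globalLB L : ℝ) := hlb ▸ (hs N hN).cost_le
      obtain ⟨L, rfl⟩ := Multiset.exists_cons_of_mem hN
      by_cases h : ∃ i ψi j ψj, N.Conflict i ψi j ψj
      · obtain ⟨i, ψi, j, ψj, h⟩ := h
        exact ⟨_, .expands L N hsel i j ψi ψj h⟩
      · exact ⟨_, .returns L N hsel h⟩
  · exact .inl ⟨_, .expandDone L N⟩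
  · exact .inl ⟨_, .childStart L N i ψ todo⟩
  · left
    rcases Query.progress (I := I) (hs.2.1.le_threshold hw hdelay i ψ) σ with
      h | ⟨p, b, h⟩ | ⟨σ', h⟩
    · exact ⟨_, .childFails L N todo i ψ σ h⟩
    · exact ⟨_, .childFinds L N todo i ψ σ p b h⟩
    · exact ⟨_, .childExpands L N todo i ψ σ σ' h⟩
  · exact .inr (.inl ⟨P, rfl⟩)
  · exact .inr (.inr rfl)

/-- The weight of an unexpanded CT node, if no node has more than `M` constraints. -/
def weight (M : ℕ) (N : CTNode V k) : ℕ :=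
  10 ^ (M - N.size)

/-- The work on the constraint tree that is left, if no CT node has more than `M` constraints. -/
noncomputable def treeWork (M : ℕ) : State V k → ℕ
  | .root plan => 10 ^ M + 2 * {i | plan i = none}.ncard + 1
  | .rootSearch plan _ _ => 10 ^ M + 2 * {i | plan i = none}.ncard
  | .main L => (L.map (weight M)).sum
  | .expand L N todo => (L.map (weight M)).sum + todo.length * (10 ^ (M - N.size - 1) + 2) + 1
  | .childSearch L N todo _ _ _ =>
      (L.map (weight M)).sum + todo.length * (10 ^ (M - N.size - 1) + 2) +
        (10 ^ (M - N.size - 1) + 2)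
  | .solved _ => 0
  | .failed => 0

/-- The work on the current low-level search that is left. -/
noncomputable def searchWork (I : Instance V k) (A : Params V k) : State V k → ℕ
  | .rootSearch plan i σ => (rootQuery plan i).remaining I A σ
  | .childSearch _ N _ i ψ σ => (childQuery A I N i ψ).remaining I A σ
  | _ => 0

/-- Low-level expansions lower only the second component; all other steps lower the first. With x =
10^(M − size − 1), expanding a node of weight 10x leaves 2(x + 2) + 1 < 10x. The surplus 2 per child
pays for starting its search and for ending it, the final 1 for `expandDone`. In the root, each
unplanned agent likewise carries 2. -/
theorem work_lt [Finite V] (hw : 1 ≤ A.w) (hh : I.Admissible A.h) (hQ : I.IsSolution Q)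
    {B : ℕ} (hs : s.Sound I A) (hc' : s'.Covers I A.w Q) (hb : s.Bounded B)
    (hb' : s'.Bounded B) (h : Step I A s s') :
    toLex (s'.treeWork (CTNode.maxSize k V B), s'.searchWork I A) <
      toLex (s.treeWork (CTNode.maxSize k V B), s.searchWork I A) := by
  rw [Prod.Lex.toLex_lt_toLex]
  generalize hM : CTNode.maxSize k V B = M
  cases h with
  | rootStart plan i hi => exact .inl (Nat.lt_succ_self _)
  | rootExpands plan i σ σ' h => exact .inr ⟨rfl, Query.remaining_lt hw hh (hQ.1 i) hs.2.1 h⟩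
  | rootFinds plan i σ p b h =>
    left
    have hlt : {j | Function.update plan i (some (p, b)) j = none}.ncard <
        {j | plan j = none}.ncard := by
      refine Set.ncard_lt_ncard ⟨fun j hj => ?_, fun hsub => ?_⟩ (Set.toFinite _)
      · rcases eq_or_ne j i with rfl | hne
        · simp at hj
        · simpa [hne] using hj
      · simpa using hsub hs.2.2
    simp only [treeWork]
    omega
  | rootFails plan i σ h => exact hc'.elim
  | rootDone P b =>
    left
    simp only [treeWork, Multiset.map_singleton, Multiset.sum_singleton, weight]
    have := Nat.pow_le_pow_right (show 0 < 10 by norm_num)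
      (Nat.sub_le M (⟨fun _ => ∅, P, b⟩ : CTNode V k).size)
    omega
  -- This step would leave the measure at zero, so it has to be excluded by coverage.
  | exhausted => exact hc'.elim
  | returns L N hsel hno =>
    left
    simp only [treeWork, Multiset.map_cons, Multiset.sum_cons, weight]
    positivity
  | expands L N hsel i j ψi ψj hconf =>
    left
    -- Needed because the subtraction is truncated: only for `N.size < M` is the weight 10 times
    -- that of a child. The timestep bound for the new constraint comes from the state after the
    -- step.
    have hlt : N.size < M := hM ▸ CTNode.size_lt_maxSize hb'.2.1
      (hconf.notMem (hs N (Multiset.mem_cons_self _ _))) (hb'.2.2 (i, ψi) (by simp))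
    simp only [treeWork, Multiset.map_cons, Multiset.sum_cons, weight, List.length_cons,
      List.length_nil]
    have h1 : 10 ^ (M - N.size) = 10 * 10 ^ (M - N.size - 1) := by
      rw [← pow_succ']; congr 1; omega
    have h2 : 0 < 10 ^ (M - N.size - 1) := by positivity
    omega
  | expandDone L N => exact .inl (by simp [treeWork])
  | childStart L N i ψ todo =>
    left
    simp only [treeWork, List.length_cons, Nat.add_mul]
    omega
  | childExpands L N todo i ψ σ σ' h =>
    exact .inr ⟨rfl, Query.remaining_lt hw hh (hQ.1 i) hs.2.2.2 h⟩
  | childFinds L N todo i ψ σ p b h =>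
    left
    simp only [treeWork, Multiset.map_cons, Multiset.sum_cons, weight,
      CTNode.size_child (hs.2.2.1 _ List.mem_cons_self), Nat.sub_add_eq]
    omega
  | childFails L N todo i ψ σ h =>
    exact .inl (Nat.add_lt_add_left (Nat.succ_lt_succ (Nat.succ_pos _)) _)

/-- The invariant of EECBS on an instance with the solution `Q`. -/
structure Invariant (I : Instance V k) (A : Params V k) (Q : Fin k → ℕ → V) (s : State V k) :
    Prop where
  sound : s.Sound I A
  covers : s.Covers I A.w Q
  bounded : s.Bounded ⌊A.w * (I.soc Q : ℝ)⌋₊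

theorem sound_initialState : (initialState V k).Sound I A := by
  intro i p b h
  simp at h

theorem invariant_initialState : (initialState V k).Invariant I A Q :=
  ⟨sound_initialState, trivial, trivial⟩

theorem Invariant.step (hw : 1 ≤ A.w) (hh : I.Admissible A.h)
    (hdelay : ∀ (Nhat : CTNode V k) (i : Fin k) (Ψ : Finset (Constraint V)),
      0 ≤ ∑ ψ ∈ Ψ, A.delay Nhat i Ψ ψ)
    (hQ : I.IsSolution Q) (hs : s.Invariant I A Q) (h : Step I A s s') : s'.Invariant I A Q :=
  ⟨hs.sound.step hh hdelay h, hs.covers.step hw hQ hs.sound h,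
    hs.bounded.step hw hQ hs.sound hs.covers h⟩

end State

/-! ### Invariants along executions and the two claims -/

theorem Reachable.sound (hh : I.Admissible A.h)
    (hdelay : ∀ (Nhat : CTNode V k) (i : Fin k) (Ψ : Finset (Constraint V)),
      0 ≤ ∑ ψ ∈ Ψ, A.delay Nhat i Ψ ψ)
    {s : State V k} (h : Reachable I A s) : s.Sound I A := by
  induction h with
  | refl => exact State.sound_initialState
  | tail _ hstep ih => exact ih.step hh hdelay hstep

theorem Reachable.invariant (hw : 1 ≤ A.w) (hh : I.Admissible A.h)
    (hdelay : ∀ (Nhat : CTNode V k) (i : Fin k) (Ψ : Finset (Constraint V)),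
      0 ≤ ∑ ψ ∈ Ψ, A.delay Nhat i Ψ ψ)
    {Q : Fin k → ℕ → V} (hQ : I.IsSolution Q) {s : State V k} (h : Reachable I A s) :
    s.Invariant I A Q := by
  induction h with
  | refl => exact State.invariant_initialState
  | tail _ hstep ih => exact ih.step hw hh hdelay hQ hstep

/-- The returned `P` is itself a solution, so the minimum C* is attained by some `Q`. The execution
is then analysed against this optimal `Q`, as the invariant holds for every solution. -/
theorem isBoundedSuboptimalOn (hw : 1 ≤ A.w) (hh : I.Admissible A.h)
    (hdelay : ∀ (Nhat : CTNode V k) (i : Fin k) (Ψ : Finset (Constraint V)),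
      0 ≤ ∑ ψ ∈ Ψ, A.delay Nhat i Ψ ψ) : IsBoundedSuboptimalOn I A := by
  intro P hP
  have hsol : I.IsSolution P := hP.sound hh hdelay
  have hmem := Nat.sInf_mem (s := {c | ∃ Q, I.IsSolution Q ∧ I.soc Q = c}) ⟨_, P, hsol, rfl⟩
  refine ⟨hsol, _, ⟨hmem, fun c hc => Nat.sInf_le hc⟩, ?_⟩
  obtain ⟨Q, hQ, hcost⟩ := hmem
  rw [← hcost]
  exact (hP.invariant hw hh hdelay hQ).covers

theorem not_exists_infinite_run [Finite V] (hw : 1 ≤ A.w) (hh : I.Admissible A.h)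
    (hdelay : ∀ (Nhat : CTNode V k) (i : Fin k) (Ψ : Finset (Constraint V)),
      0 ≤ ∑ ψ ∈ Ψ, A.delay Nhat i Ψ ψ)
    {Q : Fin k → ℕ → V} (hQ : I.IsSolution Q) :
    ¬ ∃ run : ℕ → State V k, run 0 = initialState V k ∧
      ∀ n, Step I A (run n) (run (n + 1)) := by
  rintro ⟨run, h0, hstep⟩
  have hinv : ∀ n, (run n).Invariant I A Q := by
    intro n
    induction n with
    | zero => exact h0 ▸ State.invariant_initialState
    | succ n ih => exact ih.step hw hh hdelay hQ (hstep n)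
  have hlt := fun n => State.work_lt hw hh hQ (hinv n).sound (hinv (n + 1)).covers
    (hinv n).bounded (hinv (n + 1)).bounded (hstep n)
  obtain ⟨n, hn⟩ := WellFounded.not_rel_apply_succ (r := (· < ·)) fun n =>
    toLex ((run n).treeWork (CTNode.maxSize k V ⌊A.w * (I.soc Q : ℝ)⌋₊), (run n).searchWork I A)
  exact hn (hlt n)

theorem isCompleteOn [Finite V] (hw : 1 ≤ A.w) (hh : I.Admissible A.h)
    (hdelay : ∀ (Nhat : CTNode V k) (i : Fin k) (Ψ : Finset (Constraint V)),
      0 ≤ ∑ ψ ∈ Ψ, A.delay Nhat i Ψ ψ) : IsCompleteOn I A := by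
  rintro ⟨Q, hQ⟩
  refine ⟨not_exists_infinite_run hw hh hdelay hQ, fun s hs hend => ?_⟩
  have hinv := hs.invariant hw hh hdelay hQ
  rcases hinv.sound.progress hw hdelay with h | ⟨P, rfl⟩ | rfl
  · exact absurd h hend
  · exact ⟨P, rfl, hinv.sound⟩
  · exact hinv.covers.elim

end MAPF

theorem theorem2 {V : Type*} [Finite V] {k : ℕ} (I : MAPF.Instance V k) (A : MAPF.Params V k)
    (hw : 1 ≤ A.w) (hh : I.Admissible A.h)
    (hdelay : ∀ (Nhat : MAPF.CTNode V k) (i : Fin k) (Ψ : Finset (MAPF.Constraint V)),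
      0 ≤ ∑ ψ ∈ Ψ, A.delay Nhat i Ψ ψ) :
    MAPF.IsCompleteOn I A ∧ MAPF.IsBoundedSuboptimalOn I A := by
  exact ⟨MAPF.isCompleteOn hw hh hdelay, MAPF.isBoundedSuboptimalOn hw hh hdelay⟩
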